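/- Let $d\ge 1$, let $\mathcal F$ be the set of finite subsets of $\mathbb Z^d$, and equip $\mathbb Z^d$ with the $\ell^1$-distance. For $n\in\mathbb N=\{1,2,\dots\}$ put $\Lambda_n=[0,n)^d\cap\mathbb Z^d$; a cube of side length $n$ is a translate of $\Lambda_n$. For $\Lambda\in\mathcal F$ and $r\in\mathbb N_0$, let $\partial^r(\Lambda)$ be the set of the points of $\Lambda$ at distance at most $r$ from $\mathbb Z^d\setminus\Lambda$ together with the points of $\mathbb Z^d\setminus\Lambda$ at distance at most $r$ from $\Lambda$. Let $\mathcal A\subseteq\mathbb R$, let $\Omega=\mathcal A^{\mathbb Z^d}$ with the product $\mathcal B(\Omega)$ of the Borel $\sigma$-algebras, let $(\tau_z\omega)_x=\omega_{x+z}$ and let $\omega_\Lambda$ denote the restriction of $\omega$ to $\Lambda$. Let $\mathbb P$ be a probability measure on $(\Omega,\mathcal B(\Omega))$ such that * (M1) $\mathbb P\circ\tau_z^{-1}=\mathbb P$ for all $z\in\mathbb Z^d$; * (M2) there are $\sigma$-finite measures $\mu_z$ ($z\in\mathbb Z^d$) on $\mathcal A$ such that for each $\Lambda\in\mathcal F$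 the law $\mathbb P_\Lambda$ of $\omega_\Lambda$ is absolutely continuous with respect to $\mu_\Lambda=\bigotimes_{z\in\Lambda}\mu_z$, with density $\rho_\Lambda$; * (M3) for some $r\in\mathbb N_0$: for all $n\in\mathbb N$ and all non-empty finite $\Lambda^{(1)},\dots,\Lambda^{(n)}\subseteq\mathbb Z^d$ with pairwise distances greater than $r$ and union $\Lambda$, one has $\rho_\Lambda(\omega)=\prod_j\rho_{\Lambda^{(j)}}(\omega_{\Lambda^{(j)}})$ for $\mu_\Lambda$-almost every $\omega\in\mathcal A^\Lambda$. Let $\mathbb B$ be the Banach space of bounded right-continuous functions $\mathbb R\to\mathbb R$ with the supremum norm $\|\cdot\|$. A function $f:\mathcal F\times\Omega\to\mathbb B$ is called admissible if * (i) $f(\Lambda+z,\omega)=f(\Lambda,\tau_z\omega)$ for all $\Lambda,z,\omega$; * (ii) $f(\Lambda,\omega)=f(\Lambda,\omega')$ whenever $\omega_\Lambda=\omega'_\Lambda$; * (iii) $f$ has a boundary term, that is, there is $b:\mathcal F\to[0,\infty)$ with $\bigl\|f(\bigcup_{i=1}^n\Lambda^{(i)},\omega)-\sum_{i=1}^n f(\Lambda^{(i)},\omega)\bigr\|\le\sum_{i=1}^n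 b(\Lambda^{(i)})$ for all $\omega$ and all pairwise disjoint $\Lambda^{(1)},\dots,\Lambda^{(n)}\in\mathcal F$, with $b(\Lambda+z)=b(\Lambda)$ for all $\Lambda,z$, with $b(\Lambda)\le D|\Lambda|$ for some $D>0$ and all $\Lambda$, and with $b(Q_i)/|Q_i|\to0$ for every sequence $(Q_i)$ of cubes of strictly increasing side lengths; * (iv) there is $s\in\{-1,1\}^{\mathbb Z^d}$ such that for all $\Lambda\in\mathcal F$, $z\in\Lambda$, $E\in\mathbb R$ and all $\omega,\omega'\in\Omega$ with $\omega_{\Lambda\setminus\{z\}}=\omega'_{\Lambda\setminus\{z\}}$ and $\omega_z\le\omega'_z$: $f(\Lambda,\omega)(E)\le f(\Lambda,\omega')(E)$ if $s(z)=1$, and $f(\Lambda,\omega)(E)\ge f(\Lambda,\omega')(E)$ if $s(z)=-1$; * (v) $\sup_{\omega\in\Omega}\|f(\{0\},\omega)\|<\infty$. For $K,D,D'>0$ and $r'\in\mathbb N$ let $\mathcal U_{K,D,D',r'}$ be the set of the admissible $f$ with $\|f(\Lambda,\omega)\|\le K|\Lambda|$ for all non-empty $\Lambda\in\mathcal F$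 and all $\omega\in\Omega$ which have a boundary term $b$ with $b(\Lambda)\le D|\Lambda|$ for all $\Lambda\in\mathcal F$ and $b(\Lambda)\le D'|\partial^{r'}(\Lambda)|$ for all cubes $\Lambda$. Then for every admissible $f$ there is $f^*\in\mathbb B$ such that $\bigl\|f(\Lambda_n,\omega)/|\Lambda_n|-f^*\bigr\|\to0$ as $n\to\infty$ for all $\omega$ in some measurable set of full measure. Moreover, for all $K,D,D'>0$ and $r'\in\mathbb N$ there is a set $\tilde\Omega\in\mathcal B(\Omega)$ with $\mathbb P(\tilde\Omega)=1$ such that: 1. for all $\omega\in\tilde\Omega$, $$\sup_{f\in\mathcal U_{K,D,D',r'}}\ \sup_{E\in\mathbb R}\left|\frac{f(\Lambda_n,\omega)(E)}{|\Lambda_n|}-f^*(E)\right|\xrightarrow[n\to\infty]{}0;$$ 2. if $f$ is admissible and $f(\Lambda_n,\omega):\mathbb R\to\mathbb R$ is isotone (non-decreasing) for all $n\in\mathbb N$ and all $\omega\in\tilde\Omega$, then $f^*$ is isotone; 3. in particular, if $f$ is admissible and $f(\Lambda_n,\omega)/|\Lambda_n|$ is the cumulative distribution function of a probability measure on $\mathbb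 R$ for all $n\in\mathbb N$ and all $\omega\in\tilde\Omega$, then so is $f^*$. -/

import Mathlib

open MeasureTheory Filter Topology

noncomputable section

namespace LatticeGC

/-! ### The lattice and its geometry -/

/-- The lattice `ℤ^d`. -/
abbrev Site (d : ℕ) : Type := Fin d → ℤ

/-- The `ℓ¹`-distance on `ℤ^d`. -/
def l1dist {d : ℕ} (x y : Site d) : ℕ := ∑ i, (y i - x i).natAbs

/-- The translate `Λ + z` of a finite set `Λ ⊆ ℤ^d`. -/
def translateSet {d : ℕ} (Λ : Finset (Site d)) (z : Site d) : Finset (Site d) :=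
  Λ.map (addRightEmbedding z)

/-- The cube `Λ_n = [0, n)^d ∩ ℤ^d`. -/
def box (d n : ℕ) : Finset (Site d) := Fintype.piFinset fun _ => Finset.Ico (0 : ℤ) n

/-- The cube `([0, n)^d ∩ ℤ^d) + z` of side length `n`. -/
def cube {d : ℕ} (n : ℕ) (z : Site d) : Finset (Site d) := translateSet (box d n) z

/-- The (two-sided) `r`-boundary `∂^r(Λ)`: the points of `Λ` at distance at most `r` from the
complement of `Λ`, and the points of the complement at distance at most `r` from `Λ`. -/
def rBoundary {d : ℕ} (r : ℕ) (Λ : Finset (Site d)) : Set (Site d) :=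
  {x | x ∈ Λ ∧ ∃ y, y ∉ Λ ∧ l1dist x y ≤ r} ∪ {x | x ∉ Λ ∧ ∃ y ∈ Λ, l1dist x y ≤ r}

/-! ### Colorings and the assumptions on the probability measure -/

/-- The sample space `Ω = 𝒜^(ℤ^d)`, which carries the product of the Borel `σ`-algebras of
`𝒜 ⊆ ℝ`. -/
abbrev Coloring (d : ℕ) (A : Set ℝ) : Type := Site d → A

/-- The translation `(τ_z ω)_x = ω_{x + z}`. -/
def shift {d : ℕ} {A : Set ℝ} (z : Site d) (ω : Coloring d A) : Coloring d A :=
  fun x => ω (x + z)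

/-- The marginal `P_Λ` of `P` on `𝒜^Λ`. -/
def marginal {d : ℕ} {A : Set ℝ} (P : Measure (Coloring d A)) (Λ : Finset (Site d)) :
    Measure (Λ → A) :=
  P.map (Finset.restrict Λ)

/-- The product measure `μ_Λ = ⨂_{z ∈ Λ} μ_z` on `𝒜^Λ`. -/
def refMeasure {d : ℕ} {A : Set ℝ} (μ : Site d → Measure A) (Λ : Finset (Site d)) :
    Measure (Λ → A) :=
  Measure.pi fun z : Λ => μ z

/-- The density `ρ_Λ = dP_Λ / dμ_Λ`. -/
def density {d : ℕ} {A : Set ℝ} (P : Measure (Coloring d A)) (μ : Site d → Measure A)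
    (Λ : Finset (Site d)) : (Λ → A) → ENNReal :=
  (marginal P Λ).rnDeriv (refMeasure μ Λ)

/-- Translation invariance of `P`. -/
def TranslationInvariant {d : ℕ} {A : Set ℝ} (P : Measure (Coloring d A)) : Prop :=
  ∀ z : Site d, P.map (shift z) = P

/-- Existence of densities with respect to the reference measures `μ_z`. -/
def HasDensities {d : ℕ} {A : Set ℝ} (P : Measure (Coloring d A))
    (μ : Site d → Measure A) : Prop :=
  (∀ z, SigmaFinite (μ z)) ∧ ∀ Λ : Finset (Site d), marginal P Λ ≪ refMeasure μ Λ

/-- Independence at a distance, with correlation length `r`: if `Λ_1, …, Λ_n` are non-empty with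
mutual distances larger than `r` and `Λ` is their union, then
`ρ_Λ(ω) = ∏_j ρ_{Λ_j}(ω_{Λ_j})` (as densities, that is, `μ_Λ`-almost everywhere). -/
def IndependentAtDistance {d : ℕ} {A : Set ℝ} (P : Measure (Coloring d A))
    (μ : Site d → Measure A) (r : ℕ) : Prop :=
  ∀ n : ℕ, 1 ≤ n → ∀ Λs : Fin n → Finset (Site d),
    (∀ j, (Λs j).Nonempty) →
    (∀ i j, i ≠ j → ∀ x ∈ Λs i, ∀ y ∈ Λs j, r < l1dist x y) →
    density P μ (Finset.univ.biUnion Λs)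
      =ᵐ[refMeasure μ (Finset.univ.biUnion Λs)]
        fun ω => ∏ j, density P μ (Λs j)
          (fun z => ω ⟨z, Finset.mem_biUnion.2 ⟨j, Finset.mem_univ j, z.2⟩⟩)

/-- The standing assumptions on `P`: translation invariance, existence of densities, and
independence at a distance with correlation length `r`. -/
def StandingAssumptions {d : ℕ} {A : Set ℝ} (P : Measure (Coloring d A)) (r : ℕ) : Prop :=
  TranslationInvariant P ∧
    ∃ μ : Site d → Measure A, HasDensities P μ ∧ IndependentAtDistance P μ r

/-! ### The Banach space of bounded right-continuous functions -/

/-- The space `𝔹` of bounded right-continuous functions `ℝ → ℝ` with the supremum norm, as a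
subspace of the Banach space `ℓ^∞(ℝ)` of all bounded functions. -/
def RCB : Submodule ℝ (lp (fun _ : ℝ => ℝ) ⊤) where
  carrier := {F | ∀ x : ℝ, ContinuousWithinAt (fun E => F E) (Set.Ici x) x}
  add_mem' := fun {F G} hF hG x => by
    exact (hF x).add (hG x)
  zero_mem' := fun x => by
    simpa using continuousWithinAt_const
  smul_mem' := fun c F hF x => by
    simpa using (hF x).const_mul c

instance : CoeFun RCB (fun _ => ℝ → ℝ) := ⟨fun F => F.1⟩

/-- `F` is the cumulative distribution function of a probability measure on `ℝ`. -/
def IsCDF (F : ℝ → ℝ) : Prop :=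
  ∃ ν : Measure ℝ, IsProbabilityMeasure ν ∧ ∀ E, F E = ProbabilityTheory.cdf ν E

/-! ### Admissible functions -/

/-- Functions `f : ℱ × Ω → 𝔹`, where `ℱ` is the set of finite subsets of `ℤ^d`. -/
abbrev SetField (d : ℕ) (A : Set ℝ) : Type := Finset (Site d) → Coloring d A → RCB

/-- `b : ℱ → [0, ∞)` is a boundary term for `f`: it controls the deviation of `f` from
additivity, is translation invariant, is bounded by a multiple of the cardinality, and is of
lower order along cubes of strictly increasing side lengths. -/
structure IsBoundaryTerm {d : ℕ} {A : Set ℝ} (f : SetField d A) (b : Finset (Site d) → ℝ) :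
    Prop where
  nonneg : ∀ Λ, 0 ≤ b Λ
  almost_additive : ∀ (ω : Coloring d A) (n : ℕ), 1 ≤ n →
    ∀ Λs : Fin n → Finset (Site d), Pairwise (fun i j => Disjoint (Λs i) (Λs j)) →
      ‖f (Finset.univ.biUnion Λs) ω - ∑ i, f (Λs i) ω‖ ≤ ∑ i, b (Λs i)
  translate_eq : ∀ Λ z, b (translateSet Λ z) = b Λ
  le_card : ∃ D : ℝ, 0 < D ∧ ∀ Λ, b Λ ≤ D * Λ.card
  tendsto_cube : ∀ (z : ℕ → Site d) (l : ℕ → ℕ), (∀ i, 1 ≤ l i) → StrictMono l →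
    Tendsto (fun i => b (cube (l i) (z i)) / ((cube (l i) (z i)).card : ℝ)) atTop (𝓝 0)

/-- Admissible functions `f : ℱ × Ω → 𝔹`. The sign vector `s ∈ {-1, 1}^(ℤ^d)` in the monotonicity
condition takes its values in the units of `ℤ`. -/
structure Admissible {d : ℕ} {A : Set ℝ} (f : SetField d A) : Prop where
  translation : ∀ Λ z ω, f (translateSet Λ z) ω = f Λ (shift z ω)
  locality : ∀ Λ ω ω', (∀ x ∈ Λ, ω x = ω' x) → f Λ ω = f Λ ω'
  almost_additive : ∃ b, IsBoundaryTerm f b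
  monotone : ∃ s : Site d → ℤˣ, ∀ (Λ : Finset (Site d)) (ω ω' : Coloring d A),
    ∀ z ∈ Λ, ∀ E : ℝ, (∀ x ∈ Λ, x ≠ z → ω x = ω' x) → ω z ≤ ω' z →
      (s z = 1 → f Λ ω E ≤ f Λ ω' E) ∧ (s z = -1 → f Λ ω' E ≤ f Λ ω E)
  bounded : ∃ C : ℝ, ∀ ω, ‖f {0} ω‖ ≤ C

/-- The class `𝒰_{K,D,D',r'}` of the admissible functions `f` such that
`‖f(Λ,ω)‖ ≤ K |Λ|` for all non-empty `Λ` and all `ω`, and which have a boundary term `b` with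
`b(Λ) ≤ D |Λ|` for all `Λ` and `b(Λ) ≤ D' |∂^{r'}(Λ)|` for all cubes `Λ`. -/
def AdmissibleClass (d : ℕ) (A : Set ℝ) (K D D' : ℝ) (r' : ℕ) : Set (SetField d A) :=
  {f | Admissible f ∧
    (∀ (Λ : Finset (Site d)) (ω : Coloring d A), Λ.Nonempty → ‖f Λ ω‖ / (Λ.card : ℝ) ≤ K) ∧
    ∃ b, IsBoundaryTerm f b ∧ (∀ Λ, b Λ ≤ D * Λ.card) ∧
      ∀ (n : ℕ) (z : Site d), 1 ≤ n →
        b (cube n z) ≤ D' * ((rBoundary r' (cube n z)).ncard : ℝ)}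

/-- `F ∈ 𝔹` is the almost sure limit of `f(Λ_n, ω) / |Λ_n|` in `𝔹`: there is a measurable set of
full measure on which the convergence holds in supremum norm. -/
def IsAlmostSureLimit {d : ℕ} {A : Set ℝ} (P : Measure (Coloring d A)) (f : SetField d A)
    (F : RCB) : Prop :=
  ∃ S : Set (Coloring d A), MeasurableSet S ∧ P S = 1 ∧ ∀ ω ∈ S,
    Tendsto (fun n : ℕ => ‖((box d n).card : ℝ)⁻¹ • f (box d n) ω - F‖) atTop (𝓝 0)

end LatticeGC

end

open LatticeGC

open MeasureTheory Filter Topology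

noncomputable section

namespace LatticeGC

-- After flipping the signs of some coordinates, `f Λ ω E` is increasing in every coordinate of `ω`.
-- Bounded increasing functions form a Glivenko–Cantelli class for a law absolutely continuous with
-- respect to a product measure. To see this, cut each axis at finitely many points so that the open
-- intervals left over have small mass; a heavy atom is then itself a cut point. An increasing
-- function lies between two functions of the cell. Lowering the coordinates one at a time makes the
-- gap telescope, so it is small in mean under the product measure; Markov's inequality and absolute
-- continuity carry this over to the law itself. All empirical means are thus controlled by the
-- frequencies of finitely many cells, chosen before the function
-- (`exists_partition_average_bound`).
--
-- Cubes of side `p` placed on the sublattice of mesh `p + r` carry pairwise independent,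
-- identically distributed patterns, so the cell frequencies converge by a second moment argument
-- (`ae_tendsto_frequency`). Only countably many scales, accuracies, sign vectors and cells occur,
-- hence one null set serves all functions (`exists_block_average_limit`).
--
-- Almost additivity compares `f` on a large cube with the sum over these blocks
-- (`norm_box_sub_sum_blocks_le`). Per site the cost tends to the boundary density `b(Λ_p)/|Λ_p|`
-- plus a multiple of the corridor fraction `1 - (p/(p+r))^d`, and both vanish as `p → ∞`. The
-- normalized values are therefore uniformly close to deterministic numbers, hence Cauchy, and
-- completeness of `RCB` yields the limit (`exists_convergesOn`).

/-! ### Quantization of a coordinate -/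

/-- The index of the cell of `x` in the partition of `ℝ` into the points of `T` (even levels) and
the open intervals between consecutive points of `T` (odd levels). -/
def gridLevel (T : Finset ℝ) (x : ℝ) : ℕ :=
  1 + (T.filter (· < x)).card + (T.filter (· ≤ x)).card

/-- The level from which a cell increases: the preceding point for an open interval, the point
itself for a singleton. -/
def lowerLevel (c : ℕ) : ℕ := if Odd c then c - 1 else c

theorem lowerLevel_le (c : ℕ) : lowerLevel c ≤ c := by
  unfold lowerLevel; split_ifs <;> omega

theorem gridLevel_mono (T : Finset ℝ) : Monotone (gridLevel T) := by
  intro x y h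
  unfold gridLevel
  gcongr

theorem gridLevel_le (T : Finset ℝ) (x : ℝ) : gridLevel T x ≤ 1 + 2 * T.card := by
  have h1 := Finset.card_filter_le T (· < x)
  have h2 := Finset.card_filter_le T (· ≤ x)
  unfold gridLevel; omega

theorem gridLevel_pos (T : Finset ℝ) (x : ℝ) : 1 ≤ gridLevel T x := by
  unfold gridLevel; omega

theorem measurable_gridLevel (T : Finset ℝ) : Measurable (gridLevel T) :=
  (gridLevel_mono T).measurable

theorem lt_of_gridLevel_lt {T : Finset ℝ} {x y : ℝ} (h : gridLevel T x < gridLevel T y) : x < y :=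
  (gridLevel_mono T).reflect_lt h

theorem gridLevel_lt_of_lt_of_mem {T : Finset ℝ} {x y : ℝ} (h : x < y) (hy : y ∈ T) :
    gridLevel T x < gridLevel T y := by
  unfold gridLevel
  have h1 : (T.filter (· < x)).card ≤ (T.filter (· < y)).card :=
    Finset.card_le_card fun t ht => by
      simp only [Finset.mem_filter] at ht ⊢; exact ⟨ht.1, ht.2.trans h⟩
  have h2 : (T.filter (· ≤ x)).card < (T.filter (· ≤ y)).card := by
    refine Finset.card_lt_card ⟨fun t ht => ?_, fun hc => ?_⟩
    · simp only [Finset.mem_filter] at ht ⊢; exact ⟨ht.1, ht.2.trans h.le⟩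
    · have := hc (Finset.mem_filter.2 ⟨hy, le_rfl⟩)
      exact absurd (Finset.mem_filter.1 this).2 (not_le.2 h)
  omega

theorem gridLevel_lt_of_mem_of_lt {T : Finset ℝ} {x y : ℝ} (h : x < y) (hx : x ∈ T) :
    gridLevel T x < gridLevel T y := by
  unfold gridLevel
  have h1 : (T.filter (· ≤ x)).card ≤ (T.filter (· ≤ y)).card :=
    Finset.card_le_card fun t ht => by
      simp only [Finset.mem_filter] at ht ⊢; exact ⟨ht.1, ht.2.trans h.le⟩
  have h2 : (T.filter (· < x)).card < (T.filter (· < y)).card := by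
    refine Finset.card_lt_card ⟨fun t ht => ?_, fun hc => ?_⟩
    · simp only [Finset.mem_filter] at ht ⊢; exact ⟨ht.1, ht.2.trans h⟩
    · have := hc (Finset.mem_filter.2 ⟨hx, h⟩)
      exact absurd (Finset.mem_filter.1 this).2 (lt_irrefl _)
  omega

theorem odd_gridLevel_iff (T : Finset ℝ) (x : ℝ) : Odd (gridLevel T x) ↔ x ∉ T := by
  by_cases hx : x ∈ T
  · have : T.filter (· ≤ x) = insert x (T.filter (· < x)) := by
      ext t
      simp only [Finset.mem_filter, Finset.mem_insert, le_iff_lt_or_eq]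
      constructor
      · rintro ⟨h, h' | h'⟩
        · exact Or.inr ⟨h, h'⟩
        · exact Or.inl h'
      · rintro (rfl | h)
        · exact ⟨hx, Or.inr rfl⟩
        · exact ⟨h.1, Or.inl h.2⟩
    simp only [hx, not_true_eq_false, iff_false, Nat.not_odd_iff_even, gridLevel]
    rw [this, Finset.card_insert_of_notMem (by simp)]
    exact ⟨(T.filter (· < x)).card + 1, by ring⟩
  · have : T.filter (· ≤ x) = T.filter (· < x) := by
      refine Finset.filter_congr fun t ht => ⟨fun h => h.lt_of_ne ?_, le_of_lt⟩
      rintro rfl; exact hx ht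
    simp only [hx, not_false_eq_true, iff_true, gridLevel]
    rw [this]
    exact ⟨(T.filter (· < x)).card, by ring⟩

theorem eq_of_gridLevel_eq_of_not_odd {T : Finset ℝ} {x y : ℝ}
    (h : gridLevel T x = gridLevel T y) (hx : ¬ Odd (gridLevel T x)) : x = y := by
  rw [odd_gridLevel_iff, not_not] at hx
  rcases lt_trichotomy x y with h' | h' | h'
  · exact absurd h (gridLevel_lt_of_mem_of_lt h' hx).ne
  · exact h'
  · exact absurd h (gridLevel_lt_of_lt_of_mem h' hx).ne'

/-- A level determines a point only on even cells, which are singletons. On an odd cell one must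
drop to a strictly smaller level before points become comparable; this is why `lowerLevel` moves odd
levels only. -/
theorem le_of_gridLevel_le_lowerLevel {T : Finset ℝ} {x y : ℝ}
    (h : gridLevel T y ≤ lowerLevel (gridLevel T x)) : y ≤ x := by
  unfold lowerLevel at h
  split_ifs at h with ho
  · have := gridLevel_pos T x
    exact (lt_of_gridLevel_lt (T := T) (by omega)).le
  · rcases h.lt_or_eq with h | h
    · exact (lt_of_gridLevel_lt h).le
    · exact (eq_of_gridLevel_eq_of_not_odd h.symm ho).ge

/-- Finitely many points cut `ℝ` into intervals of small mass. -/
theorem exists_finset_ordConnected_measure_le (ν : Measure ℝ) [IsProbabilityMeasure ν] (M : ℕ)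
    (hM : 0 < M) : ∃ T : Finset ℝ, ∀ S : Set ℝ, S.OrdConnected → Disjoint S (T : Set ℝ) →
      ν S ≤ ENNReal.ofReal (1 / M) := by
  classical
  have hM' : (0 : ℝ) < M := by exact_mod_cast hM
  -- The `j/M`-quantiles of `ν`. Where no genuine quantile exists (`j = 0`, or a level never
  -- attained) `sInf` returns `0`; an extra cut point is harmless.
  set t : ℕ → ℝ := fun j => sInf {x | (j : ℝ) / M ≤ ν.real (Set.Iic x)} with ht
  refine ⟨(Finset.range (M + 1)).image t, fun S hS hd => ?_⟩
  have key : ∀ x y, x ∈ S → y ∈ S → x ≤ y → ν.real (Set.Icc x y) ≤ 1 / M := by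
    intro x y hx hy hxy
    set a := ν.real (Set.Iio x) with ha
    have ha0 : 0 ≤ a := measureReal_nonneg
    have ha1 : a ≤ 1 := measureReal_le_one
    have hsum : ν.real (Set.Iic y) = a + ν.real (Set.Icc x y) := by
      rw [← Set.Iio_union_Icc_eq_Iic hxy, measureReal_union _ measurableSet_Icc]
      exact Set.disjoint_left.2 fun z hz hz' => absurd hz (not_lt.2 hz'.1)
    -- The first multiple of `1/M` strictly above the mass to the left of `x`. If `[x, y]` had mass
    -- above `1/M`, the quantile `t j` would lie in `[x, y] ⊆ S`.
    set j := ⌊M * a⌋₊ + 1 with hj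
    have hj1 : a < (j : ℝ) / M := by
      rw [lt_div_iff₀ hM', mul_comm]
      simpa [hj] using Nat.lt_floor_add_one (M * a)
    have hj2 : (j : ℝ) / M ≤ a + 1 / M := by
      rw [div_le_iff₀ hM', add_mul, one_div_mul_cancel hM'.ne', mul_comm a]
      have := Nat.floor_le (show 0 ≤ M * a by positivity)
      rw [hj]; push_cast; linarith
    by_contra hc
    rw [not_le] at hc
    have hyj : (j : ℝ) / M ≤ ν.real (Set.Iic y) := by rw [hsum]; linarith
    have hlow : ∀ z ∈ {x | (j : ℝ) / M ≤ ν.real (Set.Iic x)}, x ≤ z := by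
      intro z hz
      by_contra hzx
      rw [not_le] at hzx
      have : ν.real (Set.Iic z) ≤ a :=
        measureReal_mono (fun w hw => lt_of_le_of_lt hw hzx)
      exact absurd (hj1.trans_le hz) (not_lt.2 this)
    have htx : x ≤ t j := le_csInf ⟨y, hyj⟩ hlow
    have hty : t j ≤ y := csInf_le ⟨x, hlow⟩ hyj
    have hjM : j ≤ M := by
      have : (j : ℝ) / M ≤ 1 := hyj.trans measureReal_le_one
      rw [div_le_one hM'] at this
      exact_mod_cast this
    refine Set.disjoint_left.1 hd (hS.out hx hy ⟨htx, hty⟩) ?_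
    exact Finset.mem_coe.2 (Finset.mem_image_of_mem _ (Finset.mem_range.2 (by omega)))
  -- `S` need not contain its endpoints; a compact subset has a least and a greatest element in `S`,
  -- to which `key` applies.
  rw [hS.measurableSet.measure_eq_iSup_isCompact]
  refine iSup₂_le fun K hKS => iSup_le fun hK => ?_
  rcases K.eq_empty_or_nonempty with rfl | hne
  · simp
  obtain ⟨x, hx⟩ := hK.exists_isLeast hne
  obtain ⟨y, hy⟩ := hK.exists_isGreatest hne
  calc ν K ≤ ν (Set.Icc x y) := measure_mono fun z hz => ⟨hx.2 hz, hy.2 hz⟩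
    _ = ENNReal.ofReal (ν.real (Set.Icc x y)) := (ofReal_measureReal (measure_ne_top _ _)).symm
    _ ≤ _ := ENNReal.ofReal_le_ofReal (key x y (hKS hx.1) (hKS hy.1) (hx.2 hy.1))

theorem measure_gridLevel_fiber_le {ν : Measure ℝ} {T : Finset ℝ} {δ : ENNReal}
    (hT : ∀ S : Set ℝ, S.OrdConnected → Disjoint S (T : Set ℝ) → ν S ≤ δ) {c : ℕ} (hc : Odd c) :
    ν (gridLevel T ⁻¹' {c}) ≤ δ := by
  refine hT _ ⟨fun x hx y hy z hz => ?_⟩ (Set.disjoint_left.2 fun x hx hxT => ?_)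
  · exact le_antisymm (((gridLevel_mono T) hz.2).trans_eq hy)
      ((Eq.symm hx : c = gridLevel T x).trans_le ((gridLevel_mono T) hz.1))
  · have : Odd (gridLevel T x) := by rw [Set.mem_preimage.1 hx]; exact hc
    exact (odd_gridLevel_iff T x).1 this hxT

/-! ### Telescoping of bounded monotone functions of the levels -/

theorem sum_range_ofReal_sub_le {V : ℕ → ℝ} (hV : Monotone V) (hb : ∀ c, |V c| ≤ 1) (n : ℕ) :
    ∑ l ∈ Finset.range n, ENNReal.ofReal (V l - V (l - 1)) ≤ 2 := by
  rw [← ENNReal.ofReal_sum_of_nonneg fun l _ => sub_nonneg.2 (hV (Nat.sub_le l 1))]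
  -- Truncated subtraction makes the term `l = 0` vanish.
  have : ∑ l ∈ Finset.range n, (V l - V (l - 1)) = V (n - 1) - V 0 := by
    induction n with
    | zero => simp
    | succ n ih => rw [Finset.sum_range_succ, ih]; simp
  rw [this]
  have h1 := abs_le.1 (hb (n - 1))
  have h2 := abs_le.1 (hb 0)
  calc ENNReal.ofReal (V (n - 1) - V 0) ≤ ENNReal.ofReal 2 :=
        ENNReal.ofReal_le_ofReal (by linarith)
    _ = 2 := by simp

/-- Even levels contribute nothing, however large their mass. Each odd level contributes one
increment of `V` times at most `δ`, and the increments add up to at most `2`. -/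
theorem lintegral_level_sub_lowerLevel_le {α : Type*} [MeasurableSpace α] {ν : Measure α}
    {k : α → ℕ} (hk : Measurable k) {δ : ENNReal} (hδ : ∀ c, Odd c → ν (k ⁻¹' {c}) ≤ δ)
    {V : ℕ → ℝ} (hV : Monotone V) (hb : ∀ c, |V c| ≤ 1) :
    ∫⁻ a, ENNReal.ofReal (V (k a) - V (lowerLevel (k a))) ∂ν ≤ 2 * δ := by
  have : ∫⁻ a, ENNReal.ofReal (V (k a) - V (lowerLevel (k a))) ∂ν =
      ∫⁻ c, ENNReal.ofReal (V c - V (lowerLevel c)) ∂(ν.map k) := by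
    rw [lintegral_map (measurable_from_nat) hk]
  rw [this, lintegral_countable']
  refine ENNReal.tsum_le_of_sum_range_le fun n => ?_
  calc ∑ c ∈ Finset.range n, ENNReal.ofReal (V c - V (lowerLevel c)) * (ν.map k) {c}
      ≤ ∑ c ∈ Finset.range n, ENNReal.ofReal (V c - V (c - 1)) * δ := by
        refine Finset.sum_le_sum fun c _ => ?_
        rw [Measure.map_apply hk (measurableSet_singleton c)]
        by_cases ho : Odd c
        · rw [lowerLevel, if_pos ho]; gcongr; exact hδ c ho
        · rw [lowerLevel, if_neg ho]; simp
    _ ≤ 2 * δ := by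
        rw [← Finset.sum_mul]; gcongr; exact sum_range_ofReal_sub_le hV hb n

-- Several coordinates: oscillation and bracketing of monotone functions.

section Product

variable {ι α : Type*}

/-- The vector of levels of the coordinates `h i (x i)`. -/
def levels (T : ι → Finset ℝ) (h : ι → α → ℝ) (x : ι → α) : ι → ℕ :=
  fun i => gridLevel (T i) (h i (x i))

theorem measurable_levels [MeasurableSpace α] (T : ι → Finset ℝ) {h : ι → α → ℝ}
    (hh : ∀ i, Measurable (h i)) :
    Measurable (levels T h) :=
  measurable_pi_lambda _ fun i =>
    (measurable_gridLevel (T i)).comp ((hh i).comp (measurable_pi_apply i))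

/-- Oscillation of a bounded monotone function of the levels, summed over all cells: the
coordinates are lowered one after the other. -/
theorem lintegral_levels_sub_lower_le [Fintype ι] [MeasurableSpace α] {ν : ι → Measure α}
    [∀ i, IsProbabilityMeasure (ν i)]
    {T : ι → Finset ℝ} {h : ι → α → ℝ} (hh : ∀ i, Measurable (h i)) {δ : ENNReal}
    (hδ : ∀ i c, Odd c → (ν i) ((fun a => gridLevel (T i) (h i a)) ⁻¹' {c}) ≤ δ)
    {U : (ι → ℕ) → ℝ} (hU : Monotone U) (hb : ∀ c, |U c| ≤ 1) :
    ∫⁻ x, ENNReal.ofReal (U (levels T h x) - U (fun i => lowerLevel (levels T h x i)))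
      ∂(Measure.pi ν) ≤ Fintype.card ι * (2 * δ) := by
  classical
  let low : Finset ι → (ι → ℕ) → (ι → ℕ) := fun s c i => if i ∈ s then lowerLevel (c i) else c i
  have hlm : ∀ s, Measurable fun x => U (low s (levels T h x)) := fun s =>
    (measurable_of_countable (fun c => U (low s c))).comp (measurable_levels T hh)
  have hstep : ∀ s : Finset ι, ∀ i ∉ s,
      ∫⁻ x, ENNReal.ofReal (U (low s (levels T h x)) - U (low (insert i s) (levels T h x)))
        ∂(Measure.pi ν) ≤ 2 * δ := by
    intro s i hi
    set F : (ι → α) → ENNReal := fun x =>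
      ENNReal.ofReal (U (low s (levels T h x)) - U (low (insert i s) (levels T h x))) with hF
    have hFm : Measurable F := ((hlm s).sub (hlm _)).ennreal_ofReal
    obtain ⟨x₀⟩ : Nonempty (ι → α) := ⟨fun i => (nonempty_of_isProbabilityMeasure (ν i)).some⟩
    -- Integrate over coordinate `i` first: with the others frozen, this is the one-dimensional
    -- bound for the section `V`.
    rw [lintegral_eq_lmarginal_univ x₀, lmarginal_erase' _ hFm (Finset.mem_univ i)]
    have hone : ∀ x, ∫⁻ a, F (Function.update x i a) ∂(ν i) ≤ 2 * δ := by
      intro x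
      set V : ℕ → ℝ := fun l => U (Function.update (low s (levels T h x)) i l) with hV
      have hVm : Monotone V := fun a b hab => hU (update_le_update_iff.2 ⟨hab, by simp⟩)
      have heq : ∀ a, F (Function.update x i a) =
          ENNReal.ofReal (V (gridLevel (T i) (h i a)) -
            V (lowerLevel (gridLevel (T i) (h i a)))) := by
        intro a
        simp only [hF, hV]
        congr 3
        · ext j
          by_cases hj : j = i
          · subst hj; simp [low, levels, hi]
          · simp [low, levels, hj]
        · ext j
          by_cases hj : j = i
          · subst hj; simp [low, levels]
          · simp [low, levels, hj]
      simp_rw [heq]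
      exact lintegral_level_sub_lowerLevel_le ((measurable_gridLevel (T i)).comp (hh i)) (hδ i) hVm
        (fun c => hb _)
    calc _ ≤ (∫⋯∫⁻_Finset.univ.erase i, (fun _ => 2 * δ) ∂ν) x₀ :=
          lmarginal_mono (fun x => hone x) x₀
      _ ≤ 2 * δ := by simp [lmarginal]
  have hmain : ∀ s : Finset ι,
      ∫⁻ x, ENNReal.ofReal (U (levels T h x) - U (low s (levels T h x))) ∂(Measure.pi ν)
        ≤ s.card * (2 * δ) := by
    intro s
    induction s using Finset.induction_on with
    | empty => simp [low]
    | insert i s hi ih =>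
      calc _ ≤ ∫⁻ x, (ENNReal.ofReal (U (levels T h x) - U (low s (levels T h x))) +
              ENNReal.ofReal (U (low s (levels T h x)) - U (low (insert i s) (levels T h x))))
              ∂(Measure.pi ν) := by
            refine lintegral_mono fun x => ?_
            refine le_trans (le_of_eq ?_) ENNReal.ofReal_add_le
            congr 1; ring
        _ ≤ s.card * (2 * δ) + 2 * δ := by
            rw [lintegral_add_right _ (by exact ((hlm s).sub (hlm _)).ennreal_ofReal)]
            exact add_le_add ih (hstep s i hi)
        _ = _ := by rw [Finset.card_insert_of_notMem hi]; push_cast; ring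
  simpa [low] using hmain Finset.univ

/-- A bounded function that is monotone in the coordinates `h i (x i)` lies between two functions
of the levels. -/
theorem exists_level_bracket (T : ι → Finset ℝ) (h : ι → α → ℝ) {g : (ι → α) → ℝ}
    (hg : ∀ x y, (∀ i, h i (x i) ≤ h i (y i)) → g x ≤ g y) (hb : ∀ x, |g x| ≤ 1) :
    ∃ U : (ι → ℕ) → ℝ, Monotone U ∧ (∀ c, |U c| ≤ 1) ∧
      ∀ x, U (fun i => lowerLevel (levels T h x i)) ≤ g x ∧ g x ≤ U (levels T h x) := by
  -- `U c` is the supremum of `g` over points of level at most `c`; the value `-1` keeps it defined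
  -- and bounded when there are none. Points below the lowered level of `x` are coordinatewise below
  -- `x`, so this one `U` gives both brackets.
  set S : (ι → ℕ) → Set ℝ := fun c => insert (-1) (g '' {y | levels T h y ≤ c}) with hS
  have hSb : ∀ c, ∀ v ∈ S c, v ≤ 1 := by
    rintro c v (rfl | ⟨y, -, rfl⟩)
    · norm_num
    · exact (abs_le.1 (hb y)).2
  have hbdd : ∀ c, BddAbove (S c) := fun c => ⟨1, hSb c⟩
  refine ⟨fun c => sSup (S c), fun c c' hc => ?_, fun c => abs_le.2 ⟨?_, ?_⟩, fun x => ⟨?_, ?_⟩⟩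
  · exact csSup_le_csSup (hbdd c') ⟨-1, Or.inl rfl⟩
      (Set.insert_subset_insert (Set.image_mono fun y hy => le_trans hy hc))
  · exact le_csSup (hbdd c) (Or.inl rfl)
  · exact csSup_le ⟨-1, Or.inl rfl⟩ (hSb c)
  · refine csSup_le ⟨-1, Or.inl rfl⟩ ?_
    rintro v (rfl | ⟨y, hy, rfl⟩)
    · exact (abs_le.1 (hb x)).1
    · exact hg _ _ fun i => le_of_gridLevel_le_lowerLevel (hy i)
  · exact le_csSup (hbdd _) (Or.inr ⟨x, le_refl (levels T h x), rfl⟩)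

end Product

/-! ### Uniform approximation of empirical means of monotone functions -/

/-- By Tonelli, one coordinate at a time: a partial integral of the indicator that vanishes `ν
i`-almost everywhere also vanishes `μ i`-almost everywhere. -/
theorem pi_absolutelyContinuous {ι : Type*} [Fintype ι] {X : ι → Type*}
    [∀ i, MeasurableSpace (X i)] {μ ν : ∀ i, Measure (X i)} [∀ i, SigmaFinite (μ i)]
    [∀ i, SigmaFinite (ν i)] (h : ∀ i, μ i ≪ ν i) : Measure.pi μ ≪ Measure.pi ν := by
  classical
  refine Measure.AbsolutelyContinuous.mk fun B hB h0 => ?_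
  set f : (∀ i, X i) → ENNReal := B.indicator 1 with hf
  have hfm : Measurable f := measurable_one.indicator hB
  have key : ∀ s : Finset ι, ∀ x, (∫⋯∫⁻_s, f ∂ν) x = 0 → (∫⋯∫⁻_s, f ∂μ) x = 0 := by
    intro s
    induction s using Finset.induction_on with
    | empty => intro x hx; simpa using hx
    | insert i s hi ih =>
      intro x hx
      rw [lmarginal_insert f hfm hi] at hx ⊢
      have hm : Measurable fun a => (∫⋯∫⁻_s, f ∂ν) (Function.update x i a) :=
        (hfm.lmarginal ν).comp (measurable_update x)
      rw [lintegral_eq_zero_iff hm] at hx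
      refine (lintegral_eq_zero_iff ((hfm.lmarginal μ).comp (measurable_update x))).2 ?_
      filter_upwards [(h i).ae_le hx] with a ha
      exact ih _ ha
  rcases isEmpty_or_nonempty (∀ i, X i) with he | ⟨⟨x⟩⟩
  · rw [Set.eq_empty_of_isEmpty B]; simp
  have h1 : ∀ ρ : ∀ i, Measure (X i), [∀ i, SigmaFinite (ρ i)] →
      (∫⋯∫⁻_Finset.univ, f ∂ρ) x = Measure.pi ρ B := by
    intro ρ _
    rw [← lintegral_eq_lmarginal_univ, hf, lintegral_indicator_one hB]
  rw [← h1 μ]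
  exact key _ x (by rw [h1 ν, h0])

theorem measure_lt_of_absolutelyContinuous {X : Type*} [MeasurableSpace X] {Q ν : Measure X}
    [IsFiniteMeasure Q] [SigmaFinite ν] (h : Q ≪ ν) {ε : ENNReal} (hε : ε ≠ 0) :
    ∃ δ > 0, ∀ s, MeasurableSet s → ν s < δ → Q s < ε := by
  have hi : ∫⁻ x, Q.rnDeriv ν x ∂ν ≠ ⊤ := (Measure.lintegral_rnDeriv_lt_top Q ν).ne
  obtain ⟨δ, hδ, H⟩ := exists_pos_setLIntegral_lt_of_measure_lt hi hε
  refine ⟨δ, hδ, fun s hs hs' => ?_⟩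
  have := H s hs'
  rwa [Measure.setLIntegral_rnDeriv h] at this

theorem integral_comp_eq_sum {X γ : Type*} [MeasurableSpace X] [MeasurableSpace γ]
    [MeasurableSingletonClass γ] {Q : Measure X} [IsFiniteMeasure Q] {k : X → γ}
    (hk : Measurable k) {S : Finset γ} (hS : ∀ x, k x ∈ S) (F : γ → ℝ) :
    ∫ x, F (k x) ∂Q = ∑ c ∈ S, Q.real (k ⁻¹' {c}) * F c := by
  classical
  have h1 : ∀ x, F (k x) = ∑ c ∈ S, (k ⁻¹' {c}).indicator (fun _ => F c) x := by
    intro x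
    rw [Finset.sum_eq_single_of_mem (k x) (hS x)]
    · simp
    · intro c _ hc
      exact Set.indicator_of_notMem (fun h => hc (Eq.symm h)) _
  simp_rw [h1]
  have hm : ∀ c, MeasurableSet (k ⁻¹' {c}) := fun c => hk (measurableSet_singleton c)
  rw [integral_finsetSum _ fun c _ => (integrable_const _).indicator (hm c)]
  refine Finset.sum_congr rfl fun c _ => ?_
  rw [integral_indicator_const _ (hm c), smul_eq_mul]

theorem average_comp_eq_sum {β X γ : Type*} [DecidableEq γ] {k : X → γ} {S : Finset γ}
    (hS : ∀ x, k x ∈ S) (F : γ → ℝ) (B : Finset β) (x : β → X) :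
    (∑ t ∈ B, F (k (x t))) / B.card =
      ∑ c ∈ S, ((B.filter fun t => k (x t) = c).card : ℝ) / B.card * F c := by
  rw [← Finset.sum_fiberwise_of_maps_to (fun t _ => hS (x t)), Finset.sum_div]
  refine Finset.sum_congr rfl fun c _ => ?_
  rw [Finset.sum_congr rfl fun t ht => by rw [(Finset.mem_filter.1 ht).2], Finset.sum_const,
    nsmul_eq_mul]
  ring

/-- A deterministic Glivenko–Cantelli bound: for a law that is absolutely continuous with respect
to a product measure, the empirical means of all bounded monotone functions are controlled by
the empirical frequencies of finitely many cells. -/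
theorem exists_partition_average_bound {ι α : Type*} [Fintype ι] [MeasurableSpace α]
    {μ : ι → Measure α} [∀ i, SigmaFinite (μ i)] {Q : Measure (ι → α)} [IsProbabilityMeasure Q]
    (hQ : Q ≪ Measure.pi μ) {h : ι → α → ℝ} (hh : ∀ i, Measurable (h i)) {ε : ℝ} (hε : 0 < ε) :
    ∃ k : (ι → α) → (ι → ℕ), Measurable k ∧ ∃ S : Finset (ι → ℕ), (∀ x, k x ∈ S) ∧
      ∀ g : (ι → α) → ℝ, (∀ x y, (∀ i, h i (x i) ≤ h i (y i)) → g x ≤ g y) →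
        (∀ x, |g x| ≤ 1) → ∃ γ : ℝ, |γ| ≤ 1 ∧
          ∀ {β : Type} (B : Finset β) (x : β → ι → α), B.Nonempty →
            |(∑ t ∈ B, g (x t)) / B.card - γ| ≤ ε + ∑ c ∈ S,
              |((B.filter fun t => k (x t) = c).card : ℝ) / B.card - Q.real (k ⁻¹' {c})| := by
  classical
  have hne : ∀ i, NeZero (μ i) := by
    refine fun i => ⟨fun h0 => ?_⟩
    have h1 : Measure.pi μ = 0 := by
      rw [← Measure.measure_univ_eq_zero, Measure.pi_univ]
      exact Finset.prod_eq_zero (Finset.mem_univ i) (by simp [h0])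
    rw [h1, Measure.absolutelyContinuous_zero_iff] at hQ
    exact IsProbabilityMeasure.ne_zero Q hQ
  -- An equivalent probability measure; this needs `μ i ≠ 0`, which holds since otherwise the
  -- product, and with it `Q`, would vanish.
  set ν : ι → Measure α := fun i => (μ i).toFinite with hν
  have hQν : Q ≪ Measure.pi ν :=
    hQ.trans (pi_absolutelyContinuous fun i => absolutelyContinuous_toFinite (μ i))
  set η : ENNReal := ENNReal.ofReal (ε / 3) with hη
  have hη0 : η ≠ 0 := by rw [hη, Ne, ENNReal.ofReal_eq_zero]; linarith
  have hηt : η ≠ ⊤ := ENNReal.ofReal_ne_top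
  obtain ⟨δ, hδ, hQδ⟩ := measure_lt_of_absolutelyContinuous hQν hη0
  obtain ⟨M, hM0, hM⟩ : ∃ M : ℕ, 0 < M ∧
      (Fintype.card ι : ENNReal) * (2 * ENNReal.ofReal (1 / M)) / η < δ := by
    have ht : Tendsto (fun M : ℕ => (Fintype.card ι : ENNReal) * (2 * ENNReal.ofReal (1 / M)) / η)
        atTop (𝓝 ((Fintype.card ι : ENNReal) * (2 * ENNReal.ofReal 0) / η)) := by
      refine ENNReal.Tendsto.div_const (ENNReal.Tendsto.const_mul (ENNReal.Tendsto.const_mul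
        ((ENNReal.continuous_ofReal.tendsto 0).comp tendsto_one_div_atTop_nhds_zero_nat)
        (Or.inr (by simp))) (Or.inr (by simp))) (Or.inr hη0)
    simp only [ENNReal.ofReal_zero, mul_zero, ENNReal.zero_div] at ht
    obtain ⟨M, h1, h2⟩ := ((eventually_gt_atTop 0).and (ht.eventually_lt_const hδ)).exists
    exact ⟨M, h1, h2⟩
  have hT : ∀ i, ∃ T : Finset ℝ, ∀ S : Set ℝ, S.OrdConnected → Disjoint S (T : Set ℝ) →
      ((ν i).map (h i)) S ≤ ENNReal.ofReal (1 / M) := fun i =>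
    have : IsProbabilityMeasure ((ν i).map (h i)) :=
      Measure.isProbabilityMeasure_map (hh i).aemeasurable
    exists_finset_ordConnected_measure_le _ M hM0
  choose T hT using hT
  have hfib : ∀ i c, Odd c → (ν i) ((fun a => gridLevel (T i) (h i a)) ⁻¹' {c}) ≤
      ENNReal.ofReal (1 / M) := by
    intro i c hc
    have := measure_gridLevel_fiber_le (hT i) hc
    rwa [Measure.map_apply (hh i) (measurable_gridLevel (T i) (measurableSet_singleton c))] at this
  have hk := measurable_levels T hh
  set k := levels T h with hkdef
  set S : Finset (ι → ℕ) := Fintype.piFinset fun i => Finset.range (2 + 2 * (T i).card) with hS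
  have hkS : ∀ x, k x ∈ S := fun x => Fintype.mem_piFinset.2 fun i =>
    Finset.mem_range.2 (by have := gridLevel_le (T i) (h i (x i)); simp only [k, levels]; omega)
  refine ⟨k, hk, S, hkS, fun g hg hgb => ?_⟩
  obtain ⟨U, hU, hUb, hbr⟩ := exists_level_bracket T h hg hgb
  set low : (ι → ℕ) → (ι → ℕ) := fun c i => lowerLevel (c i) with hlow
  have hUlow : ∀ c, U (low c) ≤ U c := fun c => hU fun i => lowerLevel_le (c i)
  have hmU : ∀ F : (ι → ℕ) → ℝ, Measurable fun x => F (k x) := fun F =>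
    (measurable_of_countable F).comp hk
  have hint : ∀ F : (ι → ℕ) → ℝ, (∀ c, |F c| ≤ 1) → Integrable (fun x => F (k x)) Q :=
    fun F hF => Integrable.of_bound (hmU F).aestronglyMeasurable 1
      (Eventually.of_forall fun x => hF _)
  have hosc : ∫ x, U (k x) ∂Q - ∫ x, U (low (k x)) ∂Q ≤ ε := by
    rw [← integral_sub (hint U hUb) (hint (fun c => U (low c)) fun c => hUb _),
      integral_eq_lintegral_of_nonneg_ae
        (Eventually.of_forall fun x => sub_nonneg.2 (hUlow (k x)))
        ((hmU U).sub (hmU fun c => U (low c))).aestronglyMeasurable]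
    refine ENNReal.toReal_le_of_le_ofReal hε.le ?_
    set D : (ι → α) → ENNReal := fun x => ENNReal.ofReal (U (k x) - U (low (k x))) with hD
    have hDm : Measurable D := ((hmU U).sub (hmU fun c => U (low c))).ennreal_ofReal
    -- A small mean under `ν` does not pass to `Q` directly, but smallness of the exceptional set
    -- does: Markov bounds its `ν`-mass by `δ`, so its `Q`-mass is at most `η`. With `D ≤ 2` on `B`
    -- and `D < η` off it, the mean is at most `η + 2η = ε`.
    set B : Set (ι → α) := {x | η ≤ D x} with hB
    have hBm : MeasurableSet B := measurableSet_le measurable_const hDm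
    have hνB : Measure.pi ν B < δ := by
      refine lt_of_le_of_lt ?_ hM
      refine (meas_ge_le_lintegral_div hDm.aemeasurable hη0 hηt).trans ?_
      gcongr
      exact lintegral_levels_sub_lower_le hh hfib hU hUb
    have hQB := (hQδ B hBm hνB).le
    calc ∫⁻ x, D x ∂Q ≤ ∫⁻ x, (η + B.indicator (fun _ => 2) x) ∂Q := by
          refine lintegral_mono fun x => ?_
          by_cases hx : x ∈ B
          · rw [Set.indicator_of_mem hx]
            refine le_trans ?_ le_add_self
            calc D x ≤ ENNReal.ofReal 2 := ENNReal.ofReal_le_ofReal (by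
                  have h1 := abs_le.1 (hUb (k x)); have h2 := abs_le.1 (hUb (low (k x))); linarith)
              _ = 2 := by simp
          · rw [Set.indicator_of_notMem hx, add_zero]
            exact (not_le.1 hx).le
      _ = η + 2 * Q B := by
          rw [lintegral_add_left measurable_const, lintegral_const, measure_univ, mul_one,
            lintegral_indicator_const hBm]
      _ ≤ η + 2 * η := by gcongr
      _ = ENNReal.ofReal ε := by
          rw [hη, ← one_add_mul, show (1 : ENNReal) + 2 = ENNReal.ofReal 3 by norm_num,
            ← ENNReal.ofReal_mul (by norm_num)]
          congr 1; ring
  refine ⟨∫ x, U (k x) ∂Q, ?_, fun {β} B x hB => ?_⟩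
  · have h1 : ∀ᵐ x ∂Q, ‖U (k x)‖ ≤ 1 := Eventually.of_forall fun x => hUb (k x)
    simpa using norm_integral_le_of_norm_le_const h1
  have hdev : ∀ F : (ι → ℕ) → ℝ, (∀ c, |F c| ≤ 1) →
      |(∑ t ∈ B, F (k (x t))) / B.card - ∫ x, F (k x) ∂Q| ≤ ∑ c ∈ S,
        |((B.filter fun t => k (x t) = c).card : ℝ) / B.card - Q.real (k ⁻¹' {c})| := by
    intro F hF
    rw [average_comp_eq_sum hkS, integral_comp_eq_sum hk hkS, ← Finset.sum_sub_distrib]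
    refine (Finset.abs_sum_le_sum_abs _ _).trans (Finset.sum_le_sum fun c _ => ?_)
    rw [← sub_mul, abs_mul]
    exact mul_le_of_le_one_right (abs_nonneg _) (hF c)
  have h1 := abs_le.1 (hdev U hUb)
  have h2 := abs_le.1 (hdev (fun c => U (low c)) fun c => hUb _)
  have hup : (∑ t ∈ B, g (x t)) / B.card ≤ (∑ t ∈ B, U (k (x t))) / B.card := by
    gcongr with t ht; exact (hbr (x t)).2
  have hlo : (∑ t ∈ B, U (low (k (x t)))) / B.card ≤ (∑ t ∈ B, g (x t)) / B.card := by
    gcongr with t ht; exact (hbr (x t)).1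
  rw [abs_le]
  constructor <;> linarith [h1.1, h1.2, h2.1, h2.2]

section Blocks

/-! ### Independence of distant blocks -/

open ProbabilityTheory

theorem lintegral_pi_union_mul {ι α : Type*} [DecidableEq ι] [MeasurableSpace α]
    {μ : ι → Measure α} [∀ i, SigmaFinite (μ i)] {s t : Finset ι} (h : Disjoint s t)
    {f : (s → α) → ENNReal} {g : (t → α) → ENNReal} (hf : Measurable f) (hg : Measurable g) :
    ∫⁻ ω : (↥(s ∪ t) → α), f (Finset.restrict₂ (π := fun _ => α) Finset.subset_union_left ω) *
        g (Finset.restrict₂ (π := fun _ => α) Finset.subset_union_right ω) ∂(Measure.pi fun i : ↥(s ∪ t) => μ i) =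
      (∫⁻ x, f x ∂(Measure.pi fun i : s => μ i)) * ∫⁻ y, g y ∂(Measure.pi fun i : t => μ i) := by
  rw [← lintegral_prod_mul hf.aemeasurable hg.aemeasurable,
    (measurePreserving_piFinsetUnion h μ).lintegral_map_equiv]
  refine lintegral_congr fun z => ?_
  obtain ⟨x, y⟩ := z
  congr 2
  · ext i
    exact Equiv.piFinsetUnion_left (fun _ => α) h i.2 _
  · ext i
    exact Equiv.piFinsetUnion_right (fun _ => α) h i.2 _

variable {d : ℕ} {A : Set ℝ}

theorem marginal_apply_eq_lintegral {P : Measure (Coloring d A)} [IsProbabilityMeasure P]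
    {μ : Site d → Measure A} (hμ : HasDensities P μ) (Λ : Finset (Site d)) {C : Set (Λ → A)}
    (hC : MeasurableSet C) :
    marginal P Λ C = ∫⁻ ω, C.indicator 1 ω * density P μ Λ ω ∂(refMeasure μ Λ) := by
  have := hμ.1
  have : SigmaFinite (refMeasure μ Λ) := by unfold refMeasure; infer_instance
  have : IsProbabilityMeasure (marginal P Λ) :=
    Measure.isProbabilityMeasure_map (Finset.measurable_restrict Λ).aemeasurable
  rw [← Measure.setLIntegral_rnDeriv (hμ.2 Λ) C, ← lintegral_indicator hC]
  refine lintegral_congr fun ω => ?_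
  by_cases h : ω ∈ C <;> simp [h, density]

/-- For two sets, factorization of the density together with Tonelli is independence of the
restrictions. Pairwise independence is all that the variance estimate below requires. -/
theorem indepFun_restrict_of_distant {P : Measure (Coloring d A)} [IsProbabilityMeasure P]
    {r : ℕ} {μ : Site d → Measure A} (hμ : HasDensities P μ) (hr : IndependentAtDistance P μ r)
    {Λ₁ Λ₂ : Finset (Site d)} (h₁ : Λ₁.Nonempty) (h₂ : Λ₂.Nonempty)
    (hdist : ∀ x ∈ Λ₁, ∀ y ∈ Λ₂, r < l1dist x y) :
    IndepFun (Finset.restrict (π := fun _ => A) Λ₁) (Finset.restrict (π := fun _ => A) Λ₂) P := by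
  classical
  have := hμ.1
  have hcomm : ∀ x y : Site d, l1dist x y = l1dist y x := fun x y => by
    unfold l1dist
    exact Finset.sum_congr rfl fun i _ => by rw [← Int.natAbs_neg]; congr 1; ring
  have hd : Disjoint Λ₁ Λ₂ := Finset.disjoint_left.2 fun x hx hx' => by
    have := hdist x hx x hx'
    simp [l1dist] at this
  have hfac := hr 2 (by norm_num) ![Λ₁, Λ₂]
    (by intro j; fin_cases j; exacts [h₁, h₂])
    (by
      intro i j hij x hx y hy
      fin_cases i <;> fin_cases j
      · exact absurd rfl hij
      · exact hdist x hx y hy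
      · rw [hcomm]; exact hdist y hy x hx
      · exact absurd rfl hij)
  have hU : Finset.univ.biUnion ![Λ₁, Λ₂] = Λ₁ ∪ Λ₂ := by
    ext x; simp [Fin.exists_fin_two]
  have hfac' : density P μ (Λ₁ ∪ Λ₂) =ᵐ[refMeasure μ (Λ₁ ∪ Λ₂)] fun ω =>
      density P μ Λ₁ (Finset.restrict₂ (π := fun _ => A) Finset.subset_union_left ω) *
        density P μ Λ₂ (Finset.restrict₂ (π := fun _ => A) Finset.subset_union_right ω) := by
    simp only [Fin.prod_univ_two] at hfac
    -- The configuration space depends on the index set, so the index set is generalized before the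
    -- equality is substituted.
    have gen : ∀ (Λ : Finset (Site d)) (hΛ : Λ = Λ₁ ∪ Λ₂) (e₁ : ∀ z ∈ Λ₁, z ∈ Λ)
        (e₂ : ∀ z ∈ Λ₂, z ∈ Λ),
        (density P μ Λ =ᵐ[refMeasure μ Λ] fun ω =>
          density P μ Λ₁ (fun z : Λ₁ => ω ⟨z, e₁ z z.2⟩) *
            density P μ Λ₂ (fun z : Λ₂ => ω ⟨z, e₂ z z.2⟩)) →
        density P μ (Λ₁ ∪ Λ₂) =ᵐ[refMeasure μ (Λ₁ ∪ Λ₂)] fun ω =>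
          density P μ Λ₁ (Finset.restrict₂ (π := fun _ => A) Finset.subset_union_left ω) *
            density P μ Λ₂ (Finset.restrict₂ (π := fun _ => A) Finset.subset_union_right ω) := by
      rintro Λ rfl e₁ e₂ h
      exact h
    exact gen _ hU (fun z hz => Finset.mem_biUnion.2 ⟨0, Finset.mem_univ _, hz⟩)
      (fun z hz => Finset.mem_biUnion.2 ⟨1, Finset.mem_univ _, hz⟩) hfac
  rw [indepFun_iff_measure_inter_preimage_eq_mul]
  intro B₁ B₂ hB₁ hB₂
  have hm : ∀ (Λ : Finset (Site d)) (B : Set (Λ → A)), MeasurableSet B →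
      P (Finset.restrict Λ ⁻¹' B) = marginal P Λ B := fun Λ B hB =>
    (Measure.map_apply (Finset.measurable_restrict Λ) hB).symm
  set C : Set (↥(Λ₁ ∪ Λ₂) → A) := Finset.restrict₂ (π := fun _ => A) Finset.subset_union_left ⁻¹' B₁ ∩
    Finset.restrict₂ (π := fun _ => A) Finset.subset_union_right ⁻¹' B₂ with hC
  have hCm : MeasurableSet C := (Finset.measurable_restrict₂ _ hB₁).inter
    (Finset.measurable_restrict₂ _ hB₂)
  have hpre : Finset.restrict (π := fun _ => A) Λ₁ ⁻¹' B₁ ∩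
      Finset.restrict (π := fun _ => A) Λ₂ ⁻¹' B₂ =
      Finset.restrict (π := fun _ => A) (Λ₁ ∪ Λ₂) ⁻¹' C := rfl
  rw [hpre, hm _ C hCm, hm _ B₁ hB₁, hm _ B₂ hB₂, marginal_apply_eq_lintegral hμ _ hCm,
    marginal_apply_eq_lintegral hμ _ hB₁, marginal_apply_eq_lintegral hμ _ hB₂]
  have hdm : ∀ Λ, Measurable (density P μ Λ) := fun Λ => Measure.measurable_rnDeriv _ _
  unfold refMeasure at hfac' ⊢
  refine Eq.trans (lintegral_congr_ae ?_)
    (lintegral_pi_union_mul hd ((measurable_one.indicator hB₁).mul (hdm Λ₁))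
      ((measurable_one.indicator hB₂).mul (hdm Λ₂)))
  filter_upwards [hfac'] with ω hω
  rw [hω]
  by_cases h1 : Finset.restrict₂ (π := fun _ => A) Finset.subset_union_left ω ∈ B₁ <;>
    by_cases h2 : Finset.restrict₂ (π := fun _ => A) Finset.subset_union_right ω ∈ B₂ <;>
    simp [hC, h1, h2]

/-! ### Blocks on a sublattice -/

/-- The configuration in the cube of side length `p` at `q v`, moved to the origin. -/
def block (p q : ℕ) (v : Site d) (ω : Coloring d A) : box d p → A :=
  Finset.restrict (box d p) (shift ((q : ℤ) • v) ω)

theorem measurable_shift (z : Site d) : Measurable (shift (A := A) z) :=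
  measurable_pi_lambda _ fun x => measurable_pi_apply (x + z)

theorem measurable_block (p q : ℕ) (v : Site d) : Measurable (block (A := A) p q v) :=
  (Finset.measurable_restrict _).comp (measurable_shift _)

theorem mem_box {n : ℕ} {x : Site d} : x ∈ box d n ↔ ∀ i, 0 ≤ x i ∧ x i < n := by
  simp [box]

theorem mem_translateSet {Λ : Finset (Site d)} {z x : Site d} :
    x ∈ translateSet Λ z ↔ x - z ∈ Λ := by
  unfold translateSet
  rw [Finset.mem_map]
  constructor
  · rintro ⟨y, hy, rfl⟩; simpa using hy
  · intro h; exact ⟨x - z, h, by simp⟩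

theorem card_translateSet (Λ : Finset (Site d)) (z : Site d) :
    (translateSet Λ z).card = Λ.card := Finset.card_map _

theorem card_box (n : ℕ) : (box d n).card = n ^ d := by
  simp [box, Fintype.card_piFinset]

theorem box_nonempty {n : ℕ} (hn : 1 ≤ n) : (box d n).Nonempty :=
  ⟨0, mem_box.2 fun _ => ⟨le_rfl, by simp; omega⟩⟩

theorem map_block {P : Measure (Coloring d A)} (hP : TranslationInvariant P) (p q : ℕ)
    (v : Site d) : P.map (block p q v) = marginal P (box d p) := by
  unfold block marginal
  conv_rhs => rw [← hP ((q : ℤ) • v)]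
  rw [Measure.map_map (Finset.measurable_restrict _) (measurable_shift _)]
  rfl

/-- In a coordinate where `v` and `w` differ, the points are at least `(p + r) - (p - 1) = r + 1`
apart. -/
theorem lt_l1dist_of_blocks {p r : ℕ} {v w : Site d} (hvw : v ≠ w) {x y : Site d}
    (hx : x ∈ translateSet (box d p) (((p + r : ℕ) : ℤ) • v))
    (hy : y ∈ translateSet (box d p) (((p + r : ℕ) : ℤ) • w)) : r < l1dist x y := by
  rw [mem_translateSet, mem_box] at hx hy
  obtain ⟨i, hi⟩ := Function.ne_iff.1 hvw
  have h1 := hx i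
  have h2 := hy i
  simp only [Pi.sub_apply, Pi.smul_apply, smul_eq_mul] at h1 h2
  have h3 : (y i - x i).natAbs ≤ l1dist x y :=
    Finset.single_le_sum (f := fun i => (y i - x i).natAbs) (fun _ _ => Nat.zero_le _)
      (Finset.mem_univ i)
  refine lt_of_lt_of_le ?_ h3
  set q : ℤ := ((p + r : ℕ) : ℤ) with hq
  have hq0 : 0 ≤ q := by positivity
  push_cast at hq
  rcases lt_or_gt_of_ne hi with h | h
  · have : q * (v i + 1) ≤ q * w i := mul_le_mul_of_nonneg_left h hq0
    rw [mul_add, mul_one] at this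
    omega
  · have : q * (w i + 1) ≤ q * v i := mul_le_mul_of_nonneg_left h hq0
    rw [mul_add, mul_one] at this
    omega

theorem indepFun_block {P : Measure (Coloring d A)} [IsProbabilityMeasure P] {r : ℕ}
    (hP : StandingAssumptions P r) {p : ℕ} (hp : 1 ≤ p) {v w : Site d} (hvw : v ≠ w) :
    IndepFun (block p (p + r) v) (block p (p + r) w) P := by
  obtain ⟨-, μ, hμ, hr⟩ := hP
  have hne : ∀ z : Site d, (translateSet (box d p) z).Nonempty := fun z =>
    (box_nonempty hp).map
  have h := indepFun_restrict_of_distant hμ hr (hne (((p + r : ℕ) : ℤ) • v))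
    (hne (((p + r : ℕ) : ℤ) • w)) fun x hx y hy => lt_l1dist_of_blocks hvw hx hy
  let φ : ∀ u : Site d, (↥(translateSet (box d p) (((p + r : ℕ) : ℤ) • u)) → A) →
      (box d p → A) := fun u η x =>
    η ⟨x + ((p + r : ℕ) : ℤ) • u, mem_translateSet.2 (by simp)⟩
  have hφ : ∀ u, Measurable (φ u) := fun u =>
    measurable_pi_lambda _ fun x => measurable_pi_apply _
  exact h.comp (hφ v) (hφ w)

/-! ### Almost sure convergence of frequencies -/

/-- Pairwise independence bounds the variance of the frequency by the inverse of the number of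
sites. Along cubes of side `k ^ 2` this is at most `1 / k ^ 2` as `d ≥ 1`, which is summable. The
series of squared deviations is then almost surely finite, so its terms tend to `0`. -/
theorem ae_tendsto_frequency {Ω E : Type*} [MeasurableSpace Ω] [MeasurableSpace E]
    {P : Measure Ω} [IsProbabilityMeasure P] (hd : 1 ≤ d) {X : Site d → Ω → E}
    (hX : ∀ v, Measurable (X v)) (hind : Pairwise fun v w => IndepFun (X v) (X w) P)
    {B : Set E} (hB : MeasurableSet B) {q : ℝ} (hq : ∀ v, P.real (X v ⁻¹' B) = q)
    [∀ ω, DecidablePred fun v => X v ω ∈ B] :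
    ∀ᵐ ω ∂P, Tendsto (fun k : ℕ =>
      (((box d (k ^ 2)).filter fun v => X v ω ∈ B).card : ℝ) / (box d (k ^ 2)).card)
      atTop (𝓝 q) := by
  set Y : Site d → Ω → ℝ := fun v => B.indicator (fun _ => 1) ∘ X v with hY
  have hYm : ∀ v, Measurable (Y v) := fun v => (measurable_const.indicator hB).comp (hX v)
  have hY01 : ∀ v ω, Y v ω ∈ Set.Icc (0 : ℝ) 1 := fun v ω => by
    by_cases h : X v ω ∈ B <;> simp [hY, h]
  have hYL : ∀ v, MemLp (Y v) 2 P := fun v =>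
    MemLp.of_bound (hYm v).aestronglyMeasurable 1 (Eventually.of_forall fun ω => by
      rw [Real.norm_eq_abs, abs_of_nonneg (hY01 v ω).1]; exact (hY01 v ω).2)
  have hYE : ∀ v, ∫ ω, Y v ω ∂P = q := fun v => by
    rw [← hq v, ← integral_indicator_one (hX v hB)]
    rfl
  have hYV : ∀ v, Var[Y v; P] ≤ 1 := fun v => by
    refine (variance_le_sq_of_bounded (Eventually.of_forall (hY01 v))
      (hYm v).aemeasurable).trans (by norm_num)
  set W : ℕ → Ω → ℝ := fun k ω => ((box d (k ^ 2)).card : ℝ)⁻¹ * ∑ v ∈ box d (k ^ 2), Y v ω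
    with hW
  have hsumL : ∀ k, MemLp (fun ω => ∑ v ∈ box d (k ^ 2), Y v ω) 2 P := fun k =>
    memLp_finsetSum _ fun v _ => hYL v
  have hWL : ∀ k, MemLp (W k) 2 P := fun k => (hsumL k).const_mul _
  have hWE : ∀ k, 1 ≤ k → ∫ ω, W k ω ∂P = q := fun k hk => by
    have hN : ((box d (k ^ 2)).card : ℝ) ≠ 0 := by
      rw [card_box]; positivity
    simp only [hW]
    rw [integral_const_mul, integral_finsetSum _ fun v _ => (hYL v).integrable (by norm_num)]
    simp only [hYE, Finset.sum_const, nsmul_eq_mul]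
    rw [inv_mul_cancel_left₀ hN]
  have hWV : ∀ k, 1 ≤ k → Var[W k; P] ≤ 1 / (k : ℝ) ^ 2 := fun k hk => by
    have hN : (0 : ℝ) < ((box d (k ^ 2)).card : ℝ) := by rw [card_box]; positivity
    have h1 : Var[fun ω => ∑ v ∈ box d (k ^ 2), Y v ω; P] ≤ (box d (k ^ 2)).card := by
      have := IndepFun.variance_sum (s := box d (k ^ 2)) (X := Y) (μ := P) (fun v _ => hYL v)
        (fun v _ w _ hvw => (hind hvw).comp (measurable_const.indicator hB)
          (measurable_const.indicator hB))
      have h2 : (∑ v ∈ box d (k ^ 2), Y v) = fun ω => ∑ v ∈ box d (k ^ 2), Y v ω := by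
        ext ω; simp
      rw [← h2, this]
      exact (Finset.sum_le_sum fun v _ => hYV v).trans (by simp)
    simp only [hW]
    rw [variance_const_mul]
    have hk1 : (1 : ℝ) ≤ (k : ℝ) ^ 2 := by
      have : (1 : ℝ) ≤ k := by exact_mod_cast hk
      nlinarith
    calc _ ≤ (((box d (k ^ 2)).card : ℝ)⁻¹) ^ 2 * (box d (k ^ 2)).card := by gcongr
      _ = 1 / ((box d (k ^ 2)).card : ℝ) := by field_simp
      _ ≤ 1 / (k : ℝ) ^ 2 := by
        rw [card_box]
        push_cast
        gcongr
        exact le_self_pow₀ hk1 (by omega)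
  have hlint : ∀ k : ℕ, 1 ≤ k → ∫⁻ ω, ‖W k ω - q‖ₑ ^ 2 ∂P ≤ ENNReal.ofReal (1 / (k : ℝ) ^ 2) :=
    fun k hk => by
    have h1 : ∫⁻ ω, ‖W k ω - q‖ₑ ^ 2 ∂P = eVar[W k; P] := by
      unfold evariance; rw [hWE k hk]
    rw [h1, ← ofReal_variance (hWL k)]
    exact ENNReal.ofReal_le_ofReal (hWV k hk)
  have hWm : ∀ k, Measurable (W k) := fun k =>
    (Finset.measurable_sum _ fun v _ => hYm v).const_mul _
  -- The shift skips `k = 0`, where the cube is empty and the mean need not be `q`.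
  have htsum : ∫⁻ ω, ∑' k : ℕ, ‖W (k + 1) ω - q‖ₑ ^ 2 ∂P ≠ ⊤ := by
    rw [lintegral_tsum fun k => (((hWm (k + 1)).sub_const q).enorm.pow_const 2).aemeasurable]
    refine ne_top_of_le_ne_top ?_ (ENNReal.tsum_le_tsum fun k => hlint (k + 1) (by omega))
    have hs : Summable fun k : ℕ => 1 / ((k + 1 : ℕ) : ℝ) ^ 2 :=
      (summable_nat_add_iff 1).2 (Real.summable_one_div_nat_pow.2 one_lt_two)
    rw [← ENNReal.ofReal_tsum_of_nonneg (fun k => by positivity) hs]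
    exact ENNReal.ofReal_ne_top
  have hae := ae_lt_top' (Measurable.tsum fun k =>
    ((hWm (k + 1)).sub_const q).enorm.pow_const 2).aemeasurable htsum
  filter_upwards [hae] with ω hω
  have h0 := ENNReal.tendsto_atTop_zero_of_tsum_ne_top hω.ne
  have h1 : Tendsto (fun k => (W (k + 1) ω - q) ^ 2) atTop (𝓝 0) := by
    have h2 := (ENNReal.tendsto_toReal ENNReal.zero_ne_top).comp h0
    simpa [Function.comp_def] using h2
  have h3 : Tendsto (fun k => W (k + 1) ω - q) atTop (𝓝 0) := by
    have := h1.sqrt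
    simp only [Real.sqrt_sq_eq_abs, Real.sqrt_zero] at this
    exact (tendsto_zero_iff_abs_tendsto_zero _).2 this
  have h4 : Tendsto (fun k => W k ω) atTop (𝓝 q) := by
    rw [← tendsto_add_atTop_iff_nat 1]
    simpa using h3.add_const q
  refine h4.congr fun k => ?_
  simp only [hW, hY]
  rw [div_eq_inv_mul]
  congr 1
  simp [Set.indicator_apply]

end Blocks

section Averages

variable {d : ℕ} {A : Set ℝ}

/-! ### Estimates for admissible functions -/

theorem RCB.abs_apply_le_norm (F : RCB) (E : ℝ) : |F E| ≤ ‖F‖ :=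
  lp.norm_apply_le_norm ENNReal.top_ne_zero F.1 E

theorem RCB.sub_apply (F G : RCB) (E : ℝ) : (F - G) E = F E - G E := rfl

theorem RCB.smul_apply (c : ℝ) (F : RCB) (E : ℝ) : (c • F) E = c * F E := rfl

theorem RCB.sum_apply {κ : Type*} (s : Finset κ) (F : κ → RCB) (E : ℝ) :
    (∑ i ∈ s, F i) E = ∑ i ∈ s, F i E := by
  classical
  induction s using Finset.induction_on with
  | empty => rfl
  | insert i s hi ih => rw [Finset.sum_insert hi, Finset.sum_insert hi, ← ih]; rfl

theorem IsBoundaryTerm.almost_additive_finset {f : SetField d A} {b : Finset (Site d) → ℝ}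
    (hb : IsBoundaryTerm f b) {κ : Type*} {s : Finset κ} (hs : s.Nonempty)
    {Λs : κ → Finset (Site d)} (hd : (s : Set κ).PairwiseDisjoint Λs) (ω : Coloring d A) :
    ‖f (s.biUnion Λs) ω - ∑ i ∈ s, f (Λs i) ω‖ ≤ ∑ i ∈ s, b (Λs i) := by
  have h := hb.almost_additive ω s.card (Finset.card_pos.2 hs)
    (fun j => Λs (s.equivFin.symm j)) (fun i j hij =>
      hd (s.equivFin.symm i).2 (s.equivFin.symm j).2 fun h =>
        hij (s.equivFin.symm.injective (Subtype.ext h)))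
  have hU : Finset.univ.biUnion (fun j => Λs (s.equivFin.symm j)) = s.biUnion Λs := by
    ext x
    simp only [Finset.mem_biUnion, Finset.mem_univ, true_and]
    constructor
    · rintro ⟨j, hj⟩; exact ⟨_, (s.equivFin.symm j).2, hj⟩
    · rintro ⟨i, hi, hx⟩; exact ⟨s.equivFin ⟨i, hi⟩, by simpa using hx⟩
  rw [hU, s.equivFin.symm.sum_comp (fun i : s => f (Λs i) ω),
    s.equivFin.symm.sum_comp (fun i : s => b (Λs i)), s.sum_coe_sort (fun i => f (Λs i) ω),
    s.sum_coe_sort (fun i => b (Λs i))] at h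
  exact h

theorem IsBoundaryTerm.empty {f : SetField d A} {b : Finset (Site d) → ℝ}
    (hb : IsBoundaryTerm f b) : b ∅ = 0 := by
  obtain ⟨D, -, hD⟩ := hb.le_card
  exact le_antisymm (by simpa using hD ∅) (hb.nonneg ∅)

theorem IsBoundaryTerm.apply_empty {f : SetField d A} {b : Finset (Site d) → ℝ}
    (hb : IsBoundaryTerm f b) (ω : Coloring d A) : f ∅ ω = 0 := by
  have h := hb.almost_additive ω 2 (by norm_num) (fun _ => ∅) (fun _ _ _ => disjoint_bot_left)
  have hU : (Finset.univ : Finset (Fin 2)).biUnion (fun _ => (∅ : Finset (Site d))) = ∅ := by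
    ext x; simp
  rw [hU] at h
  simp only [Fin.sum_univ_two, hb.empty, add_zero] at h
  simpa using h

/-- Split `Λ` into singletons: each costs at most `|C|` by translation to the origin and at most `D`
for the boundary term. -/
theorem Admissible.exists_norm_le {f : SetField d A} (hf : Admissible f) :
    ∃ C : ℝ, 0 < C ∧ ∀ Λ ω, ‖f Λ ω‖ ≤ C * Λ.card := by
  obtain ⟨b, hb⟩ := hf.almost_additive
  obtain ⟨D, hD0, hD⟩ := hb.le_card
  obtain ⟨C, hC⟩ := hf.bounded
  refine ⟨|C| + D, by positivity, fun Λ ω => ?_⟩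
  rcases Λ.eq_empty_or_nonempty with rfl | hΛ
  · simp [hb.apply_empty]
  have h := hb.almost_additive_finset hΛ (Λs := fun z => {z})
    (fun x _ y _ hxy => Finset.disjoint_singleton.2 hxy) ω
  rw [Finset.biUnion_singleton_eq_self] at h
  have h1 : ∀ z : Site d, ‖f {z} ω‖ ≤ |C| := fun z => by
    have : ({z} : Finset (Site d)) = translateSet {0} z := by simp [translateSet]
    rw [this, hf.translation]
    exact (hC _).trans (le_abs_self C)
  calc ‖f Λ ω‖ ≤ ‖f Λ ω - ∑ z ∈ Λ, f {z} ω‖ + ‖∑ z ∈ Λ, f {z} ω‖ := norm_le_norm_sub_add _ _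
    _ ≤ ∑ z ∈ Λ, b {z} + ∑ z ∈ Λ, |C| :=
        add_le_add h ((norm_sum_le _ _).trans (Finset.sum_le_sum fun z _ => h1 z))
    _ ≤ ∑ z ∈ Λ, D + ∑ z ∈ Λ, |C| := by
        gcongr with z hz; simpa using hD {z}
    _ = (|C| + D) * Λ.card := by simp only [Finset.sum_const, nsmul_eq_mul]; ring

/-- Monotonicity in all coordinates at once, with the direction given by the signs. -/
theorem Admissible.exists_sign_monotone {f : SetField d A} (hf : Admissible f) :
    ∃ s : Site d → ℤˣ, ∀ (Λ : Finset (Site d)) (E : ℝ) (ω ω' : Coloring d A),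
      (∀ x ∈ Λ, ((s x : ℤ) : ℝ) * (ω x : ℝ) ≤ ((s x : ℤ) : ℝ) * (ω' x : ℝ)) →
        f Λ ω E ≤ f Λ ω' E := by
  classical
  obtain ⟨s, hs⟩ := hf.monotone
  refine ⟨s, fun Λ E ω ω' h => ?_⟩
  have key : ∀ S ⊆ Λ, f Λ ω E ≤ f Λ (fun x => if x ∈ S then ω' x else ω x) E := by
    intro S
    induction S using Finset.induction_on with
    | empty => intro _; simp
    | insert z S hz ih =>
      intro hS
      have hzΛ := hS (Finset.mem_insert_self z S)
      refine (ih fun x hx => hS (Finset.mem_insert_of_mem hx)).trans ?_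
      have hx : ∀ x, x ≠ z → (if x ∈ S then ω' x else ω x) =
          if x ∈ insert z S then ω' x else ω x := fun x hx => by simp [hx]
      have hzs := h z hzΛ
      rcases Int.units_eq_one_or (s z) with h1 | h1
      · refine (hs Λ _ _ z hzΛ E (fun x _ => hx x) ?_).1 h1
        simp only [h1, Units.val_one, Int.cast_one, one_mul] at hzs
        simpa [hz] using hzs
      · refine (hs Λ _ _ z hzΛ E (fun x _ hxz => (hx x hxz).symm) ?_).2 h1
        simp only [h1, Units.val_neg, Units.val_one, Int.cast_neg, Int.cast_one, neg_mul, one_mul,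
          neg_le_neg_iff] at hzs
        simpa [hz] using hzs
  refine (key Λ subset_rfl).trans_eq ?_
  rw [hf.locality Λ _ ω' fun x hx => by simp [hx]]

/-- The cube is cut into `K ^ d` blocks and a remainder made of the corridors and the outer margin.
The remainder enters twice: through its boundary term (`D`) and through its own value (`C`). -/
theorem norm_box_sub_sum_blocks_le {f : SetField d A} (hf : Admissible f)
    {b : Finset (Site d) → ℝ} (hb : IsBoundaryTerm f b) {C D : ℝ}
    (hC : ∀ Λ ω, ‖f Λ ω‖ ≤ C * Λ.card) (hD : ∀ Λ, b Λ ≤ D * Λ.card) {p r K n : ℕ}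
    (hn : (p + r) * K ≤ n) (ω : Coloring d A) :
    ‖f (box d n) ω - ∑ v ∈ box d K, f (box d p) (shift (((p + r : ℕ) : ℤ) • v) ω)‖ ≤
      (K : ℝ) ^ d * b (box d p) + (C + D) * ((n : ℝ) ^ d - (K : ℝ) ^ d * (p : ℝ) ^ d) := by
  classical
  set core : Site d → Finset (Site d) := fun v =>
    translateSet (box d p) (((p + r : ℕ) : ℤ) • v) with hcore
  have hsub : ∀ v ∈ box d K, core v ⊆ box d n := by
    intro v hv x hx
    rw [hcore, mem_translateSet, mem_box] at hx
    rw [mem_box] at hv ⊢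
    intro i
    have h1 := hx i
    have h2 := hv i
    simp only [Pi.sub_apply, Pi.smul_apply, smul_eq_mul] at h1
    set q : ℤ := ((p + r : ℕ) : ℤ) with hq
    have hq0 : 0 ≤ q := by positivity
    have h3 : q * (v i + 1) ≤ q * K := mul_le_mul_of_nonneg_left h2.2 hq0
    have h4 : 0 ≤ q * v i := mul_nonneg hq0 h2.1
    have h5 : q * K ≤ n := by rw [hq]; exact_mod_cast hn
    rw [mul_add, mul_one] at h3
    push_cast at hq
    omega
  have hdisj : ∀ v w, v ≠ w → Disjoint (core v) (core w) := fun v w hvw =>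
    Finset.disjoint_left.2 fun x hx hx' => by
      have := lt_l1dist_of_blocks hvw hx hx'
      simp [l1dist] at this
  set U := (box d K).biUnion core with hU
  have hUcard : U.card = K ^ d * p ^ d := by
    rw [hU, Finset.card_biUnion fun v _ w _ hvw => hdisj v w hvw]
    simp [hcore, card_translateSet, card_box]
  have hUsub : U ⊆ box d n := Finset.biUnion_subset.2 hsub
  set R := box d n \ U with hR
  have hRcard : (R.card : ℝ) = (n : ℝ) ^ d - (K : ℝ) ^ d * (p : ℝ) ^ d := by
    rw [hR, Finset.cast_card_sdiff hUsub, hUcard, card_box]; push_cast; rfl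
  -- `none` indexes the remainder, `some v` the block at `v`.
  let Λs : Option (Site d) → Finset (Site d) := fun o => o.elim R core
  have hunion : (Finset.insertNone (box d K)).biUnion Λs = box d n := by
    ext x
    simp only [Finset.mem_biUnion, Finset.mem_insertNone, Option.exists]
    constructor
    · rintro (⟨-, hx⟩ | ⟨v, hv, hx⟩)
      · exact (Finset.mem_sdiff.1 hx).1
      · exact hsub v (hv v rfl) hx
    · intro hx
      by_cases hxU : x ∈ U
      · obtain ⟨v, hv, hxv⟩ := Finset.mem_biUnion.1 hxU
        exact Or.inr ⟨v, by rintro _ ⟨⟩; exact hv, hxv⟩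
      · exact Or.inl ⟨by simp, Finset.mem_sdiff.2 ⟨hx, hxU⟩⟩
  have hRd : ∀ v ∈ box d K, Disjoint R (core v) := fun v hv =>
    Finset.disjoint_left.2 fun x hx hx' =>
      (Finset.mem_sdiff.1 hx).2 (Finset.mem_biUnion.2 ⟨v, hv, hx'⟩)
  have hpd : ((Finset.insertNone (box d K) : Finset (Option (Site d))) :
      Set (Option (Site d))).PairwiseDisjoint Λs := by
    rintro (_ | v) hv (_ | w) hw hvw
    · exact absurd rfl hvw
    · exact hRd w (by simpa using hw)
    · exact (hRd v (by simpa using hv)).symm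
    · exact hdisj v w fun h => hvw (by rw [h])
  have h := hb.almost_additive_finset (s := Finset.insertNone (box d K)) ⟨none, by simp⟩ hpd ω
  rw [hunion, Finset.sum_insertNone, Finset.sum_insertNone] at h
  have hcoref : ∀ v, f (Λs (some v)) ω = f (box d p) (shift (((p + r : ℕ) : ℤ) • v) ω) :=
    fun v => hf.translation _ _ _
  have hcoreb : ∀ v, b (Λs (some v)) = b (box d p) := fun v => hb.translate_eq _ _
  simp only [hcoref, hcoreb, Finset.sum_const, nsmul_eq_mul, card_box] at h
  set F := ∑ v ∈ box d K, f (box d p) (shift (((p + r : ℕ) : ℤ) • v) ω)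
  have hRf := hC R ω
  have hRb := hD R
  calc ‖f (box d n) ω - F‖ = ‖(f (box d n) ω - (f R ω + F)) + f R ω‖ := by
        congr 1; abel
    _ ≤ ‖f (box d n) ω - (f R ω + F)‖ + ‖f R ω‖ := norm_add_le _ _
    _ ≤ (b R + ((K ^ d : ℕ) : ℝ) * b (box d p)) + C * R.card := add_le_add h hRf
    _ ≤ _ := by rw [← hRcard]; push_cast; linarith

/-! ### Uniform convergence of block averages -/

/-- The index of the sublattice cube used inside the cube of side length `n`. -/
def blockIndex (q n : ℕ) : ℕ := Nat.sqrt (n / q)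

theorem mul_blockIndex_sq_le (q n : ℕ) : q * blockIndex q n ^ 2 ≤ n := by
  unfold blockIndex
  calc q * Nat.sqrt (n / q) ^ 2 ≤ q * (n / q) := Nat.mul_le_mul_left q (Nat.sqrt_le' _)
    _ ≤ n := Nat.mul_div_le n q

theorem tendsto_blockIndex {q : ℕ} (hq : 1 ≤ q) : Tendsto (blockIndex q) atTop atTop := by
  refine tendsto_atTop.2 fun b => ?_
  filter_upwards [eventually_ge_atTop (q * (b * b))] with n hn
  unfold blockIndex
  rw [Nat.le_sqrt, Nat.le_div_iff_mul_le hq, mul_comm]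
  exact hn

/-- Restricting to square side counts costs nothing in the limit, because consecutive squares have
ratio tending to `1`. -/
theorem tendsto_blockIndex_ratio {q : ℕ} (hq : 1 ≤ q) :
    Tendsto (fun n : ℕ => ((blockIndex q n ^ 2 : ℕ) : ℝ) / n) atTop (𝓝 (1 / (q : ℝ))) := by
  have hq' : (0 : ℝ) < q := by exact_mod_cast hq
  have hlow : Tendsto (fun n : ℕ => ((blockIndex q n : ℝ) / ((blockIndex q n : ℝ) + 1)) ^ 2 / q)
      atTop (𝓝 ((1 : ℝ) ^ 2 / q)) :=
    (((tendsto_natCast_div_add_atTop (1 : ℝ)).comp (tendsto_blockIndex hq)).pow 2).div_const _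
  rw [one_pow] at hlow
  refine tendsto_of_tendsto_of_tendsto_of_le_of_le' hlow tendsto_const_nhds ?_ ?_
  · filter_upwards [eventually_ge_atTop 1] with n hn
    have hn' : (0 : ℝ) < n := by exact_mod_cast hn
    have h1 : n ≤ q * (blockIndex q n + 1) ^ 2 := by
      have h2 : n / q + 1 ≤ (blockIndex q n + 1) ^ 2 := Nat.lt_succ_sqrt' _
      calc n ≤ q * (n / q + 1) := (Nat.lt_mul_div_succ n hq).le
        _ ≤ _ := Nat.mul_le_mul_left q h2
    have h1' : (n : ℝ) ≤ q * ((blockIndex q n : ℝ) + 1) ^ 2 := by exact_mod_cast h1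
    rw [div_pow, div_div]
    push_cast
    exact div_le_div_of_nonneg_left (by positivity) hn' (by linarith)
  · filter_upwards [eventually_ge_atTop 1] with n hn
    have hn' : (0 : ℝ) < n := by exact_mod_cast hn
    have h1 : ((q * blockIndex q n ^ 2 : ℕ) : ℝ) ≤ n := by exact_mod_cast mul_blockIndex_sq_le q n
    rw [div_le_div_iff₀ hn' hq']
    push_cast at h1 ⊢
    linarith

theorem ae_tendsto_block_frequency {P : Measure (Coloring d A)} [IsProbabilityMeasure P]
    (hd : 1 ≤ d) {r : ℕ} (hP : StandingAssumptions P r) {p : ℕ} (hp : 1 ≤ p) {Γ : Type*}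
    [MeasurableSpace Γ] [MeasurableSingletonClass Γ] [DecidableEq Γ] {k : (box d p → A) → Γ}
    (hk : Measurable k) (c : Γ) :
    ∀ᵐ ω ∂P, Tendsto (fun K : ℕ => (((box d (K ^ 2)).filter fun v =>
      k (block p (p + r) v ω) = c).card : ℝ) / (box d (K ^ 2)).card) atTop
      (𝓝 ((marginal P (box d p)).real (k ⁻¹' {c}))) := by
  classical
  have hm : MeasurableSet (k ⁻¹' {c}) := hk (measurableSet_singleton c)
  have h := ae_tendsto_frequency (P := P) (X := fun v => block p (p + r) v) (B := k ⁻¹' {c})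
    (q := (marginal P (box d p)).real (k ⁻¹' {c})) hd (fun v => measurable_block p (p + r) v)
    (fun v w hvw => indepFun_block hP hp hvw) hm fun v => by
      rw [← map_block hP.1 p (p + r) v, map_measureReal_apply (measurable_block _ _ _) hm]
  filter_upwards [h] with ω hω
  refine hω.congr fun K => ?_
  congr

/-- There is a set of full measure on which the averages over sublattice cubes of every admissible
function of a fixed cube are close to deterministic numbers, uniformly in the function. -/
theorem exists_block_average_limit {P : Measure (Coloring d A)} [IsProbabilityMeasure P]
    (hd : 1 ≤ d) {r : ℕ} (hP : StandingAssumptions P r) :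
    ∃ S : Set (Coloring d A), MeasurableSet S ∧ P S = 1 ∧
      ∀ p : ℕ, 1 ≤ p → ∀ C ε : ℝ, 0 < C → 0 < ε → ∃ γ : SetField d A → ℝ → ℝ,
        (∀ f E, |γ f E| ≤ C) ∧ ∀ ω ∈ S, ∀ᶠ K : ℕ in atTop, ∀ f, Admissible f →
          (∀ ω', ‖f (box d p) ω'‖ ≤ C) → ∀ E,
            |(∑ v ∈ box d (K ^ 2), f (box d p) (shift (((p + r : ℕ) : ℤ) • v) ω) E) /
              (box d (K ^ 2)).card - γ f E| ≤ ε := by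
  classical
  obtain ⟨ω₀⟩ : Nonempty (Coloring d A) := nonempty_of_isProbabilityMeasure P
  obtain ⟨μ, hμ, -⟩ := hP.2
  have hσ := hμ.1
  -- One partition for each scale `p`, accuracy `1 / (j + 1)` and sign vector `s`. These are
  -- countably many, and multiplication by `s i` turns the sign condition into plain monotonicity.
  have hpart : ∀ (p j : ℕ) (s : box d p → ℤˣ), _ := fun p j s =>
    have : IsProbabilityMeasure (marginal P (box d p)) :=
      Measure.isProbabilityMeasure_map (Finset.measurable_restrict _).aemeasurable
    exists_partition_average_bound (hμ.2 (box d p))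
      (h := fun i a => ((s i : ℤ) : ℝ) * (a : ℝ))
      (fun i => measurable_subtype_coe.const_mul _) (Nat.one_div_pos_of_nat (α := ℝ) (n := j))
  choose k hk T hT hbound using hpart
  have hae : ∀ᵐ ω ∂P, ∀ p : ℕ, 1 ≤ p → ∀ (j : ℕ) (s : box d p → ℤˣ) (c : box d p → ℕ),
      Tendsto (fun K : ℕ => (((box d (K ^ 2)).filter fun v =>
        k p j s (block p (p + r) v ω) = c).card : ℝ) / (box d (K ^ 2)).card) atTop
        (𝓝 ((marginal P (box d p)).real (k p j s ⁻¹' {c}))) := by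
    simp only [ae_all_iff]
    intro p hp j s c
    exact ae_tendsto_block_frequency hd hP hp (hk p j s) c
  obtain ⟨S, hSsub, hSm, hSP⟩ : ∃ S ⊆ {ω | ∀ p : ℕ, 1 ≤ p → ∀ (j : ℕ) (s : box d p → ℤˣ)
      (c : box d p → ℕ), Tendsto (fun K : ℕ => (((box d (K ^ 2)).filter fun v =>
        k p j s (block p (p + r) v ω) = c).card : ℝ) / (box d (K ^ 2)).card) atTop
        (𝓝 ((marginal P (box d p)).real (k p j s ⁻¹' {c})))}, MeasurableSet S ∧ P S = 1 := by
    obtain ⟨N, hN, hNm, hN0⟩ := exists_measurable_superset_of_null (mem_ae_iff.1 hae)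
    exact ⟨Nᶜ, Set.compl_subset_comm.1 hN, hNm.compl, (prob_compl_eq_one_iff hNm).2 hN0⟩
  refine ⟨S, hSm, hSP, fun p hp C ε hC hε => ?_⟩
  obtain ⟨j, hj⟩ := exists_nat_one_div_lt (show 0 < ε / C / 2 by positivity)
  -- Extends a pattern by the fixed `ω₀`; by locality the values outside the cube do not matter.
  set ext : (box d p → A) → Coloring d A := fun x z =>
    if h : z ∈ box d p then x ⟨z, h⟩ else ω₀ z with hext
  have hγ : ∀ (f : SetField d A) (E : ℝ), ∃ γ : ℝ, |γ| ≤ 1 ∧ (Admissible f →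
      (∀ ω', ‖f (box d p) ω'‖ ≤ C) → ∃ s : box d p → ℤˣ,
        ∀ {β : Type} (B : Finset β) (x : β → box d p → A), B.Nonempty →
          |(∑ t ∈ B, f (box d p) (ext (x t)) E / C) / B.card - γ| ≤ 1 / ((j : ℝ) + 1) +
            ∑ c ∈ T p j s, |((B.filter fun t => k p j s (x t) = c).card : ℝ) / B.card -
              (marginal P (box d p)).real (k p j s ⁻¹' {c})|) := by
    intro f E
    by_cases hf : Admissible f ∧ ∀ ω', ‖f (box d p) ω'‖ ≤ C
    · obtain ⟨s, hs⟩ := hf.1.exists_sign_monotone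
      obtain ⟨γ, hγ1, hγ2⟩ := hbound p j (fun i => s i) (fun x => f (box d p) (ext x) E / C)
        (fun x y hxy => by
          gcongr
          refine hs (box d p) E _ _ fun z hz => ?_
          simpa [hext, hz] using hxy ⟨z, hz⟩)
        (fun x => by
          rw [abs_div, abs_of_pos hC, div_le_one hC]
          exact (RCB.abs_apply_le_norm _ E).trans (hf.2 _))
      exact ⟨γ, hγ1, fun _ _ => ⟨fun i => s i, hγ2⟩⟩
    · exact ⟨0, by simp, fun h1 h2 => absurd ⟨h1, h2⟩ hf⟩
  choose γ hγ1 hγ2 using hγ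
  refine ⟨fun f E => C * γ f E, fun f E => ?_, fun ω hω => ?_⟩
  · rw [abs_mul, abs_of_pos hC]
    exact mul_le_of_le_one_right hC.le (hγ1 f E)
  -- Summing over all sign vectors dominates the one belonging to any given `f`, so the threshold
  -- for `K` is independent of `f` and `E`.
  have hlim : Tendsto (fun K : ℕ => ∑ s : box d p → ℤˣ, ∑ c ∈ T p j s,
      |(((box d (K ^ 2)).filter fun v => k p j s (block p (p + r) v ω) = c).card : ℝ) /
        (box d (K ^ 2)).card - (marginal P (box d p)).real (k p j s ⁻¹' {c})|) atTop (𝓝 0) := by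
    rw [← Finset.sum_const_zero (s := (Finset.univ : Finset (box d p → ℤˣ)))]
    refine tendsto_finsetSum _ fun s _ => ?_
    rw [← Finset.sum_const_zero (s := T p j s)]
    refine tendsto_finsetSum _ fun c _ => ?_
    have := ((hSsub hω) p hp j s c).sub_const ((marginal P (box d p)).real (k p j s ⁻¹' {c}))
    simpa using this.abs
  filter_upwards [hlim.eventually_lt_const (show 0 < ε / C / 2 by positivity),
    eventually_ge_atTop 1] with K hK hK1 f hf hfC E
  obtain ⟨s, hs⟩ := hγ2 f E hf hfC
  have h1 := hs (box d (K ^ 2)) (fun v => block p (p + r) v ω) (box_nonempty (Nat.one_le_pow _ _ hK1))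
  have h2 := Finset.single_le_sum (f := fun s : box d p → ℤˣ => ∑ c ∈ T p j s,
      |(((box d (K ^ 2)).filter fun v => k p j s (block p (p + r) v ω) = c).card : ℝ) /
        (box d (K ^ 2)).card - (marginal P (box d p)).real (k p j s ⁻¹' {c})|)
    (fun s _ => Finset.sum_nonneg fun c _ => abs_nonneg _) (Finset.mem_univ s)
  have hfe : ∀ v, f (box d p) (ext (block p (p + r) v ω)) =
      f (box d p) (shift (((p + r : ℕ) : ℤ) • v) ω) := fun v =>
    hf.locality _ _ _ fun x hx => by simp [hext, hx, block]
  simp only [hfe] at h1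
  rw [← Finset.sum_div] at h1
  have h3 := h1.trans (add_le_add hj.le (h2.trans hK.le))
  set X := ∑ v ∈ box d (K ^ 2), f (box d p) (shift (((p + r : ℕ) : ℤ) • v) ω) E
  calc |X / (box d (K ^ 2)).card - C * γ f E|
      = C * |X / C / (box d (K ^ 2)).card - γ f E| := by
        rw [← abs_of_pos hC, ← abs_mul, abs_of_pos hC]
        congr 1; field_simp
    _ ≤ C * (ε / C / 2 + ε / C / 2) := by gcongr
    _ = ε := by field_simp; ring

end Averages

-- From block averages to averages over cubes.

section CubeLimits

variable {d : ℕ} {A : Set ℝ}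

/-- The arithmetic of the comparison: `X` is the value on the large cube of volume `n`, `Y` the sum
over `N` blocks of volume `V`, and `Q` the volume of a sublattice cell, so that `N / n` is close to
`1 / Q`. -/
theorem abs_ratio_sub_le {X Y N V Q n b C D γ ε : ℝ} (hN : 0 < N) (hV : 0 < V) (hVQ : V ≤ Q)
    (hn : 0 < n) (hNQ : N * Q ≤ n) (hb : 0 ≤ b) (hCD : 0 ≤ C + D) (hε : 0 ≤ ε)
    (hXY : |X - Y| ≤ N * b + (C + D) * (n - N * V)) (hY : |Y / N - γ| ≤ ε) (hγ : |γ| ≤ C * V) :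
    |X / n - γ / Q| ≤ b / V + (C + D) * (1 - V / Q) + ε / V +
      (C + D + C) * V * |N / n - 1 / Q| := by
  have hQ : 0 < Q := hV.trans_le hVQ
  set a := N / n with ha
  have ha0 : 0 ≤ a := by positivity
  have haQ : a ≤ 1 / Q := by rw [ha, div_le_div_iff₀ hn hQ]; linarith
  have haV : a ≤ 1 / V := haQ.trans (one_div_le_one_div_of_le hV hVQ)
  have h1 : |X / n - Y / n| ≤ a * b + (C + D) * (1 - a * V) := by
    rw [← sub_div, abs_div, abs_of_pos hn, div_le_iff₀ hn]
    refine hXY.trans_eq ?_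
    rw [ha]; field_simp
  have h2 : |Y / n - a * γ| ≤ a * ε := by
    have : Y / n - a * γ = a * (Y / N - γ) := by rw [ha]; field_simp
    rw [this, abs_mul, abs_of_nonneg ha0]
    gcongr
  have h3 : |a * γ - γ / Q| ≤ C * V * |a - 1 / Q| := by
    have : a * γ - γ / Q = γ * (a - 1 / Q) := by ring
    rw [this, abs_mul]
    gcongr
  have h4 : a * b ≤ b / V := by
    rw [div_eq_mul_one_div, mul_comm]; gcongr
  have h5 : a * ε ≤ ε / V := by
    rw [div_eq_mul_one_div, mul_comm]; gcongr
  have h6 : (C + D) * (1 - a * V) ≤ (C + D) * (1 - V / Q) + (C + D) * V * |a - 1 / Q| := by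
    have h7 : 1 - a * V ≤ 1 - V / Q + V * |a - 1 / Q| := by
      have h8 : V * (1 / Q - a) ≤ V * |a - 1 / Q| := by
        gcongr; rw [abs_sub_comm]; exact le_abs_self _
      have h9 : V * (1 / Q - a) = V / Q - a * V := by ring
      linarith
    calc (C + D) * (1 - a * V) ≤ (C + D) * (1 - V / Q + V * |a - 1 / Q|) := by gcongr
      _ = _ := by ring
  have h10 : |X / n - γ / Q| ≤ |X / n - Y / n| + |Y / n - a * γ| + |a * γ - γ / Q| := by
    have h11 := abs_sub_le (X / n) (Y / n) (γ / Q)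
    have h12 := abs_sub_le (Y / n) (a * γ) (γ / Q)
    linarith
  nlinarith [h10, h1, h2, h3, h4, h5, h6]

theorem exists_cube_approximation {P : Measure (Coloring d A)} [IsProbabilityMeasure P]
    (hd : 1 ≤ d) {r : ℕ} (hP : StandingAssumptions P r) :
    ∃ S : Set (Coloring d A), MeasurableSet S ∧ P S = 1 ∧
      ∀ p : ℕ, 1 ≤ p → ∀ C D ε : ℝ, 0 < C → 0 < D → 0 < ε → ∃ γ : SetField d A → ℝ → ℝ,
        ∀ ω ∈ S, ∀ᶠ n : ℕ in atTop, ∀ f b, Admissible f → IsBoundaryTerm f b →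
          (∀ Λ ω', ‖f Λ ω'‖ ≤ C * Λ.card) → (∀ Λ, b Λ ≤ D * Λ.card) → ∀ E,
            |f (box d n) ω E / (box d n).card - γ f E| ≤
              b (box d p) / (box d p).card +
                (C + D) * (1 - ((p : ℝ) / ((p : ℝ) + r)) ^ d) + ε := by
  obtain ⟨S, hSm, hSP, hS⟩ := exists_block_average_limit hd hP
  refine ⟨S, hSm, hSP, fun p hp C D ε hC hD hε => ?_⟩
  have hp' : (0 : ℝ) < p := by exact_mod_cast hp
  set V : ℝ := (p : ℝ) ^ d with hV
  have hV0 : 0 < V := by positivity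
  set Q : ℝ := ((p + r : ℕ) : ℝ) ^ d with hQ
  have hq : 1 ≤ p + r := by omega
  have hVQ : V ≤ Q := by rw [hV, hQ]; gcongr; omega
  -- Per site the accuracy becomes `ε / 2`; the other half absorbs the deviation of `N / n` from `1
  -- / Q`.
  obtain ⟨γ, hγ, hlim⟩ := hS p hp (C * V) (ε / 2 * V) (by positivity) (by positivity)
  refine ⟨fun f E => γ f E / Q, fun ω hω => ?_⟩
  have hratio : Tendsto (fun n : ℕ => (C + D + C) * V *
      |(((blockIndex (p + r) n ^ 2 : ℕ) : ℝ) ^ d) / (n : ℝ) ^ d - 1 / Q|) atTop (𝓝 0) := by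
    have h1 := ((tendsto_blockIndex_ratio hq).pow d).sub_const (1 / Q)
    rw [div_pow, one_pow, ← hQ, sub_self] at h1
    simpa [div_pow] using h1.abs.const_mul ((C + D + C) * V)
  filter_upwards [(tendsto_blockIndex hq).eventually (hlim ω hω),
    (tendsto_blockIndex hq).eventually_ge_atTop 1, eventually_ge_atTop 1,
    hratio.eventually_le_const (half_pos hε)] with n hn hK hn1 hr f b hf hb hfC hbD E
  set K := blockIndex (p + r) n with hKdef
  have hn0 : (0 : ℝ) < n := by exact_mod_cast hn1
  have hK2 : (0 : ℝ) < ((K ^ 2 : ℕ) : ℝ) := by exact_mod_cast Nat.pow_pos hK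
  have h1 := hn f hf (fun ω' => by
    refine (hfC _ _).trans_eq ?_
    rw [card_box]; push_cast; rfl) E
  have h2 := norm_box_sub_sum_blocks_le hf hb hfC hbD (mul_blockIndex_sq_le (p + r) n) ω
  have h3 := (RCB.abs_apply_le_norm _ E).trans h2
  rw [RCB.sub_apply, RCB.sum_apply] at h3
  rw [card_box] at h1 ⊢
  rw [card_box]
  push_cast at h1 h3 hr hK2 ⊢
  have h4 := abs_ratio_sub_le (N := ((K : ℝ) ^ 2) ^ d) (V := V) (Q := Q) (n := (n : ℝ) ^ d)
    (by positivity) hV0 hVQ (by positivity) (by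
      rw [hQ, ← mul_pow, mul_comm]
      gcongr
      exact_mod_cast mul_blockIndex_sq_le (p + r) n) (hb.nonneg _) (by positivity)
      (by positivity) h3 h1 (hγ f E)
  have h5 : V / Q = ((p : ℝ) / ((p : ℝ) + r)) ^ d := by rw [hV, hQ, div_pow]; push_cast; rfl
  rw [h5, mul_div_cancel_right₀ _ hV0.ne'] at h4
  linarith

end CubeLimits

-- Uniform limits over families and the limit function.

section LimitFunction

variable {d : ℕ} {A : Set ℝ}

/-- Uniform closeness of `f(Λ_n, ω) / |Λ_n|` to deterministic numbers, for all families of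
admissible functions with common bounds. -/
theorem exists_uniform_cube_limit {P : Measure (Coloring d A)} [IsProbabilityMeasure P]
    (hd : 1 ≤ d) {r : ℕ} (hP : StandingAssumptions P r) :
    ∃ S : Set (Coloring d A), MeasurableSet S ∧ P S = 1 ∧
      ∀ (𝒰 : Set (SetField d A)) (C D : ℝ) (β : ℕ → ℝ), 0 < C → 0 < D → Tendsto β atTop (𝓝 0) →
        (∀ f ∈ 𝒰, Admissible f ∧ (∀ Λ ω, ‖f Λ ω‖ ≤ C * Λ.card) ∧ ∃ b, IsBoundaryTerm f b ∧
          (∀ Λ, b Λ ≤ D * Λ.card) ∧ ∀ p, 1 ≤ p → b (box d p) / (box d p).card ≤ β p) →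
        ∀ ε : ℝ, 0 < ε → ∃ γ : SetField d A → ℝ → ℝ, ∀ ω ∈ S, ∀ᶠ n : ℕ in atTop,
          ∀ f ∈ 𝒰, ∀ E, |f (box d n) ω E / (box d n).card - γ f E| ≤ ε := by
  obtain ⟨S, hSm, hSP, hS⟩ := exists_cube_approximation hd hP
  refine ⟨S, hSm, hSP, fun 𝒰 C D β hC hD hβ h𝒰 ε hε => ?_⟩
  have hlim : Tendsto (fun p : ℕ => β p + (C + D) * (1 - ((p : ℝ) / ((p : ℝ) + r)) ^ d)) atTop
      (𝓝 0) := by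
    have h1 := ((tendsto_natCast_div_add_atTop (r : ℝ)).pow d).const_sub 1
    simpa using hβ.add (h1.const_mul (C + D))
  obtain ⟨p, hp, hp1⟩ := ((hlim.eventually_le_const (half_pos hε)).and
    (eventually_ge_atTop 1)).exists
  obtain ⟨γ, hγ⟩ := hS p hp1 C D (ε / 2) hC hD (half_pos hε)
  refine ⟨γ, fun ω hω => ?_⟩
  filter_upwards [hγ ω hω] with n hn f hf E
  obtain ⟨hfa, hfC, b, hb, hbD, hbβ⟩ := h𝒰 f hf
  have h1 := hn f b hfa hb hfC hbD E
  have h2 := hbβ p hp1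
  linarith

/-! ### The limit function -/

theorem isClosed_RCB : IsClosed (RCB : Set (lp (fun _ : ℝ => ℝ) ⊤)) := by
  refine isClosed_of_closure_subset fun F hF x => ?_
  refine continuousWithinAt_of_locally_uniform_approx_of_continuousWithinAt
    (Set.self_mem_Ici) fun u hu => ?_
  obtain ⟨ε, hε, hu⟩ := Metric.mem_uniformity_dist.1 hu
  obtain ⟨G, hG, hFG⟩ := Metric.mem_closure_iff.1 hF ε hε
  refine ⟨Set.univ, univ_mem, fun E => G E, hG x, fun y _ => hu ?_⟩
  rw [dist_eq_norm] at hFG ⊢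
  exact (lp.norm_apply_le_norm ENNReal.top_ne_zero (F - G) y).trans_lt hFG

instance : CompleteSpace RCB := isClosed_RCB.completeSpace_coe

theorem RCB.norm_le_of_forall_abs_le {F : RCB} {C : ℝ} (hC : 0 ≤ C) (h : ∀ E, |F E| ≤ C) :
    ‖F‖ ≤ C :=
  lp.norm_le_of_forall_le hC h

theorem RCB.normalized_apply (c : ℝ) (F : RCB) (E : ℝ) : (c⁻¹ • F) E = F E / c := by
  rw [RCB.smul_apply, div_eq_inv_mul]

theorem cube_zero (n : ℕ) : cube n (0 : Site d) = box d n := by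
  ext x; rw [cube, mem_translateSet, sub_zero]

theorem IsBoundaryTerm.tendsto_box {f : SetField d A} {b : Finset (Site d) → ℝ}
    (hb : IsBoundaryTerm f b) :
    Tendsto (fun p : ℕ => b (box d p) / (box d p).card) atTop (𝓝 0) := by
  rw [← tendsto_add_atTop_iff_nat 1]
  have h := hb.tendsto_cube (fun _ => 0) (fun i => i + 1) (fun i => by omega)
    (fun i j hij => by simpa using hij)
  simpa only [cube_zero] using h

/-- The convergence towards `F` on the set `S`, in a form that mentions real numbers only. -/
def ConvergesOn (S : Set (Coloring d A)) (f : SetField d A) (F : RCB) : Prop :=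
  ∀ ω ∈ S, ∀ ε : ℝ, 0 < ε → ∀ᶠ n : ℕ in atTop, ∀ E,
    |f (box d n) ω E / (box d n).card - F E| ≤ ε

theorem ConvergesOn.tendsto_norm {S : Set (Coloring d A)} {f : SetField d A} {F : RCB}
    (h : ConvergesOn S f F) {ω : Coloring d A} (hω : ω ∈ S) :
    Tendsto (fun n : ℕ => ‖((box d n).card : ℝ)⁻¹ • f (box d n) ω - F‖) atTop (𝓝 0) := by
  rw [Metric.tendsto_nhds]
  intro ε hε
  filter_upwards [h ω hω (ε / 2) (half_pos hε)] with n hn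
  rw [Real.dist_0_eq_abs, abs_norm]
  refine (RCB.norm_le_of_forall_abs_le (half_pos hε).le fun E => ?_).trans_lt (half_lt_self hε)
  rw [RCB.sub_apply, RCB.normalized_apply]
  exact hn E

theorem ConvergesOn.tendsto_apply {S : Set (Coloring d A)} {f : SetField d A} {F : RCB}
    (h : ConvergesOn S f F) {ω : Coloring d A} (hω : ω ∈ S) (E : ℝ) :
    Tendsto (fun n : ℕ => f (box d n) ω E / (box d n).card) atTop (𝓝 (F E)) := by
  rw [Metric.tendsto_nhds]
  intro ε hε
  filter_upwards [h ω hω (ε / 2) (half_pos hε)] with n hn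
  rw [Real.dist_eq]
  exact (hn E).trans_lt (half_lt_self hε)

/-- The numbers `γ` do not depend on `ω`. They make the averages at one reference point Cauchy, and
then tie the averages at every other point of `S` to the same limit. -/
theorem exists_convergesOn {S : Set (Coloring d A)} (hS : S.Nonempty) {f : SetField d A}
    (h : ∀ ε : ℝ, 0 < ε → ∃ γ : ℝ → ℝ, ∀ ω ∈ S, ∀ᶠ n : ℕ in atTop, ∀ E,
      |f (box d n) ω E / (box d n).card - γ E| ≤ ε) : ∃ F : RCB, ConvergesOn S f F := by
  obtain ⟨ω₀, hω₀⟩ := hS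
  set u : ℕ → RCB := fun n => ((box d n).card : ℝ)⁻¹ • f (box d n) ω₀ with hu
  have hcau : CauchySeq u := by
    rw [Metric.cauchySeq_iff']
    intro ε hε
    obtain ⟨γ, hγ⟩ := h (ε / 4) (by positivity)
    obtain ⟨N, hN⟩ := eventually_atTop.1 (hγ ω₀ hω₀)
    refine ⟨N, fun n hn => ?_⟩
    rw [dist_eq_norm]
    refine (RCB.norm_le_of_forall_abs_le (half_pos hε).le fun E => ?_).trans_lt (half_lt_self hε)
    rw [RCB.sub_apply, hu, RCB.normalized_apply, RCB.normalized_apply]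
    have h1 := abs_le.1 (hN n hn E)
    have h2 := abs_le.1 (hN N le_rfl E)
    rw [abs_le]
    constructor <;> linarith [h1.1, h1.2, h2.1, h2.2]
  obtain ⟨F, hF⟩ := cauchySeq_tendsto_of_complete hcau
  refine ⟨F, fun ω hω ε hε => ?_⟩
  obtain ⟨γ, hγ⟩ := h (ε / 3) (by positivity)
  have hlim := (tendsto_iff_norm_sub_tendsto_zero.1 hF).eventually_le_const
    (show 0 < ε / 3 by positivity)
  obtain ⟨m, hm1, hm2⟩ := (hlim.and (hγ ω₀ hω₀)).exists
  filter_upwards [hγ ω hω] with n hn E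
  have h1 := abs_le.1 (hn E)
  have h2 := abs_le.1 (hm2 E)
  have h3 := (RCB.abs_apply_le_norm _ E).trans hm1
  rw [RCB.sub_apply, hu, RCB.normalized_apply] at h3
  have h4 := abs_le.1 h3
  rw [abs_le]
  constructor <;> linarith [h1.1, h1.2, h2.1, h2.2, h4.1, h4.2]

theorem ConvergesOn.monotone {S : Set (Coloring d A)} {f : SetField d A} {F : RCB}
    (h : ConvergesOn S f F) (hS : S.Nonempty)
    (hm : ∀ n : ℕ, 1 ≤ n → ∀ ω ∈ S, Monotone (f (box d n) ω)) : Monotone F := by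
  obtain ⟨ω, hω⟩ := hS
  intro E E' hE
  refine le_of_tendsto_of_tendsto (h.tendsto_apply hω E) (h.tendsto_apply hω E') ?_
  filter_upwards [eventually_ge_atTop 1] with n hn
  have := hm n hn ω hω hE
  gcongr

/-- A right-continuous uniform limit of distribution functions is a distribution function. -/
theorem isCDF_of_uniform_limit {F : ℝ → ℝ}
    (hF : ∀ x, ContinuousWithinAt F (Set.Ici x) x)
    (h : ∀ ε : ℝ, 0 < ε → ∃ G, IsCDF G ∧ ∀ E, |G E - F E| ≤ ε) : IsCDF F := by
  have hmono : Monotone F := by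
    intro x y hxy
    refine le_of_forall_pos_le_add fun ε hε => ?_
    obtain ⟨G, ⟨ν, hν, hG⟩, hGF⟩ := h (ε / 2) (half_pos hε)
    have h1 := abs_le.1 (hGF x)
    have h2 := abs_le.1 (hGF y)
    have h3 : G x ≤ G y := by rw [hG, hG]; exact ProbabilityTheory.monotone_cdf ν hxy
    linarith [h1.1, h2.2]
  have hlim : ∀ (l : Filter ℝ) (c : ℝ),
      (∀ ν : Measure ℝ, Tendsto (ProbabilityTheory.cdf ν) l (𝓝 c)) → Tendsto F l (𝓝 c) := by
    intro l c hl
    rw [Metric.tendsto_nhds]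
    intro ε hε
    obtain ⟨G, ⟨ν, hν, hG⟩, hGF⟩ := h (ε / 2) (half_pos hε)
    filter_upwards [(Metric.tendsto_nhds.1 (hl ν)) (ε / 2) (half_pos hε)] with x hx
    rw [← hG, Real.dist_eq] at hx
    rw [Real.dist_eq]
    have h1 := abs_sub_le (F x) (G x) c
    have h2 := hGF x
    rw [abs_sub_comm] at h2
    linarith
  have h0 := hlim atBot 0 fun ν => ProbabilityTheory.tendsto_cdf_atBot ν
  have h1 := hlim atTop 1 fun ν => ProbabilityTheory.tendsto_cdf_atTop ν
  let Φ : StieltjesFunction ℝ := ⟨F, hmono, hF⟩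
  refine ⟨Φ.measure, Φ.isProbabilityMeasure h0 h1, fun E => ?_⟩
  rw [ProbabilityTheory.cdf_measure_stieltjesFunction Φ h0 h1]

theorem ConvergesOn.isCDF {S : Set (Coloring d A)} {f : SetField d A} {F : RCB}
    (h : ConvergesOn S f F) (hS : S.Nonempty)
    (hm : ∀ n : ℕ, 1 ≤ n → ∀ ω ∈ S, IsCDF fun E => f (box d n) ω E / ((box d n).card : ℝ)) :
    IsCDF F := by
  obtain ⟨ω, hω⟩ := hS
  refine isCDF_of_uniform_limit F.2 fun ε hε => ?_
  obtain ⟨n, hn, hn1⟩ := ((h ω hω ε hε).and (eventually_ge_atTop 1)).exists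
  exact ⟨_, hm n hn1 ω hω, hn⟩

/-! ### Boundaries of cubes -/

/-- The two-sided boundary lies in the cube widened by `r` on every side, minus the cube narrowed by
`r` on every side. -/
theorem ncard_rBoundary_box_le {r p : ℕ} (hp : 2 * r ≤ p) :
    ((rBoundary r (box d p)).ncard : ℝ) ≤
      ((p : ℝ) + 2 * r) ^ d - ((p : ℝ) - 2 * r) ^ d := by
  classical
  set B₁ : Finset (Site d) := Fintype.piFinset fun _ => Finset.Ico (-r : ℤ) (p + r) with hB₁
  set B₂ : Finset (Site d) := Fintype.piFinset fun _ => Finset.Ico (r : ℤ) (p - r) with hB₂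
  have hcoord : ∀ (x y : Site d), l1dist x y ≤ r → ∀ i, (y i - x i).natAbs ≤ r :=
    fun x y h i => (Finset.single_le_sum (f := fun i => (y i - x i).natAbs)
      (fun _ _ => Nat.zero_le _) (Finset.mem_univ i)).trans h
  have hsub : B₂ ⊆ B₁ := Fintype.piFinset_subset _ _ fun i =>
    Finset.Ico_subset_Ico (by omega) (by omega)
  have hbd : rBoundary r (box d p) ⊆ ((B₁ \ B₂ : Finset (Site d)) : Set (Site d)) := by
    intro x hx
    rw [Finset.mem_coe, Finset.mem_sdiff]
    simp only [hB₁, hB₂, Fintype.mem_piFinset, Finset.mem_Ico]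
    rcases hx with ⟨hx, y, hy, hxy⟩ | ⟨hx, y, hy, hxy⟩
    · rw [mem_box] at hx hy
      refine ⟨fun i => ?_, fun h => hy fun i => ?_⟩
      · have := hx i; omega
      · have h1 := hcoord x y hxy i; have h2 := h i; omega
    · rw [mem_box] at hx hy
      refine ⟨fun i => ?_, fun h => hx fun i => ?_⟩
      · have h1 := hcoord x y hxy i; have h2 := hy i; omega
      · have h2 := h i; omega
  have h1 : (rBoundary r (box d p)).ncard ≤ (B₁ \ B₂).card := by
    rw [← Set.ncard_coe_finset]
    exact Set.ncard_le_ncard hbd (Finset.finite_toSet _)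
  have hc₁ : (B₁.card : ℝ) = ((p : ℝ) + 2 * r) ^ d := by
    rw [hB₁, Fintype.card_piFinset]
    simp only [Int.card_Ico, Finset.prod_const, Finset.card_univ, Fintype.card_fin]
    rw [show ((p : ℤ) + r - -r).toNat = p + 2 * r by omega]
    push_cast; rfl
  have hc₂ : (B₂.card : ℝ) = ((p : ℝ) - 2 * r) ^ d := by
    rw [hB₂, Fintype.card_piFinset]
    simp only [Int.card_Ico, Finset.prod_const, Finset.card_univ, Fintype.card_fin]
    rw [show ((p : ℤ) - r - r).toNat = p - 2 * r by omega]
    push_cast [hp]; rfl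
  rw [← hc₁, ← hc₂, ← Finset.cast_card_sdiff hsub]
  exact_mod_cast h1

theorem tendsto_ncard_rBoundary_box (r : ℕ) :
    Tendsto (fun p : ℕ => ((rBoundary r (box d p)).ncard : ℝ) / (box d p).card) atTop (𝓝 0) := by
  have h1 : ∀ c : ℝ, Tendsto (fun p : ℕ => (1 + c / p) ^ d) atTop (𝓝 1) := fun c => by
    simpa using ((tendsto_const_div_atTop_nhds_zero_nat c).const_add 1).pow d
  have h2 := (h1 (2 * r)).sub (h1 (-(2 * r)))
  rw [sub_self] at h2
  refine tendsto_of_tendsto_of_tendsto_of_le_of_le' tendsto_const_nhds h2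
    (Eventually.of_forall fun p => by positivity) ?_
  filter_upwards [eventually_ge_atTop (2 * r), eventually_ge_atTop 1] with p hp hp1
  have hp0 : (0 : ℝ) < p := by exact_mod_cast hp1
  rw [card_box]
  push_cast
  rw [div_le_iff₀ (by positivity), sub_mul, ← mul_pow, ← mul_pow]
  refine (ncard_rBoundary_box_le hp).trans_eq ?_
  congr 2 <;> field_simp
  ring

end LimitFunction

end LatticeGC

end

-- The main theorem.

open LatticeGC
theorem mainTheorem3 (d : ℕ) (hd : 1 ≤ d) (A : Set ℝ) (P : Measure (Coloring d A))
    [IsProbabilityMeasure P] (r : ℕ) (hP : StandingAssumptions P r) :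
    ∃ fstar : SetField d A → RCB,
      (∀ f, Admissible f → IsAlmostSureLimit P f (fstar f)) ∧
      ∀ (K D D' : ℝ) (r' : ℕ), 0 < K → 0 < D → 0 < D' → 1 ≤ r' →
        ∃ S : Set (Coloring d A), MeasurableSet S ∧ P S = 1 ∧
          (∀ ω ∈ S,
            Tendsto
              (fun n : ℕ => ⨆ f ∈ AdmissibleClass d A K D D' r', ⨆ E : ℝ,
                ENNReal.ofReal |f (box d n) ω E / ((box d n).card : ℝ) - fstar f E|)
              atTop (𝓝 0)) ∧
          (∀ f, Admissible f →
            (∀ n : ℕ, 1 ≤ n → ∀ ω ∈ S, Monotone (f (box d n) ω)) →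
            Monotone (fstar f)) ∧
          (∀ f, Admissible f →
            (∀ n : ℕ, 1 ≤ n → ∀ ω ∈ S,
              IsCDF fun E => f (box d n) ω E / ((box d n).card : ℝ)) →
            IsCDF (fstar f)) := by
  classical
  obtain ⟨S, hSm, hSP, hS⟩ := exists_uniform_cube_limit hd hP
  have hne : S.Nonempty := nonempty_of_measure_ne_zero (by rw [hSP]; exact one_ne_zero)
  have hlim : ∀ f : SetField d A, ∃ F : RCB, Admissible f → ConvergesOn S f F := by
    intro f
    by_cases hf : Admissible f
    · obtain ⟨C, hC0, hC⟩ := hf.exists_norm_le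
      obtain ⟨b, hb⟩ := hf.almost_additive
      obtain ⟨D, hD0, hD⟩ := hb.le_card
      obtain ⟨F, hF⟩ := exists_convergesOn hne (f := f) fun ε hε => by
        -- For a single function the uniform statement applies to the family `{f}`, with its own
        -- boundary density as `β`. The set `S` is fixed beforehand and serves every `f` and every
        -- class.
        obtain ⟨γ, hγ⟩ := hS {f} C D (fun p => b (box d p) / (box d p).card) hC0 hD0 hb.tendsto_box
          (by rintro _ rfl; exact ⟨hf, hC, b, hb, hD, fun _ _ => le_rfl⟩) ε hε
        exact ⟨γ f, fun ω hω => (hγ ω hω).mono fun n hn => hn f rfl⟩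
      exact ⟨F, fun _ => hF⟩
    · exact ⟨0, fun h => absurd h hf⟩
  choose fstar hfstar using hlim
  refine ⟨fstar, fun f hf => ⟨S, hSm, hSP, fun ω hω => (hfstar f hf).tendsto_norm hω⟩,
    fun K D D' r' hK hD hD' _ => ⟨S, hSm, hSP, fun ω hω => ?_,
      fun f hf => (hfstar f hf).monotone hne, fun f hf => (hfstar f hf).isCDF hne⟩⟩
  have hβ := (tendsto_ncard_rBoundary_box (d := d) r').const_mul D'
  rw [mul_zero] at hβ
  rw [ENNReal.tendsto_nhds_zero]
  intro ε hε
  obtain ⟨δ, hδ0, hδ⟩ : ∃ δ : ℝ, 0 < δ ∧ ENNReal.ofReal δ ≤ ε := by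
    obtain ⟨δ, -, h1, h2⟩ := ENNReal.lt_iff_exists_real_btwn.1 hε
    exact ⟨δ, ENNReal.ofReal_pos.1 h1, h2.le⟩
  obtain ⟨γ, hγ⟩ := hS (AdmissibleClass d A K D D' r') K D _ hK hD hβ
    (by
      rintro f ⟨hf, hfK, b, hb, hbD, hbr⟩
      refine ⟨hf, fun Λ ω => ?_, b, hb, hbD, fun p hp => ?_⟩
      · rcases Λ.eq_empty_or_nonempty with rfl | hΛ
        · simp [hb.apply_empty]
        · exact (div_le_iff₀ (by exact_mod_cast hΛ.card_pos)).1 (hfK Λ ω hΛ)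
      · have := hbr p 0 hp
        rw [cube_zero] at this
        rw [← mul_div_assoc]
        gcongr) (δ / 2) (half_pos hδ0)
  filter_upwards [hγ ω hω] with n hn
  refine iSup₂_le fun f hf => iSup_le fun E => (ENNReal.ofReal_le_ofReal ?_).trans hδ
  have h1 := hn f hf E
  -- `γ` depends on the accuracy and is only an intermediary: letting the cube grow, `fstar`
  -- inherits the same bound, uniformly in `f` and `E`.
  have h2 : |fstar f E - γ f E| ≤ δ / 2 :=
    le_of_tendsto (((hfstar f hf.1).tendsto_apply hω E).sub_const _).abs
      ((hγ ω hω).mono fun m hm => hm f hf E)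
  have h3 := abs_sub_le (f (box d n) ω E / (box d n).card) (γ f E) (fstar f E)
  rw [abs_sub_comm (γ f E)] at h3
  linarith
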